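/- Let $n\ge 1$, let $M$ be a smooth manifold and let $\omega\in\Omega^{n+1}(M)$ be closed (so $(M,\omega)$ is a pre-$n$-plectic manifold). Put $$L_0=\{(v,\alpha)\in\mathfrak X(M)\times\Omega^{n-1}(M)\mid d\alpha=-\iota_v\omega\},\qquad l_2\big((v,\alpha),(w,\beta)\big)=\big([v,w],\,\iota_w\iota_v\omega\big),$$ let $\mathfrak X_{Ham}(M,\omega)\subset\mathfrak X(M)$ be the image of $L_0$ under $(v,\alpha)\mapsto v$, let $\ker(\iota_\bullet\omega)=\{v\in\mathfrak X(M)\mid\iota_v\omega=0\}$, also regarded as the subspace $\{(v,0)\mid \iota_v\omega=0\}$ of $L_0$, and let $\Omega^{n-1}_{ex}(M)$ be the space of exact $(n-1)$-forms (which is $0$ if $n=1$), regarded as the subspace $\{(0,\alpha)\mid\alpha\text{ exact}\}$ of $L_0$. Then $l_2$ induces a Lie bracket $\bar l_2$ on $\bar L_0:=L_0/(\Omega^{n-1}_{ex}(M)\oplus\ker(\iota_\bullet\omega))$, the projection $L_0\to\mathfrak X_{Ham}(M,\omega)$ induces a map $\bar\pi:\bar L_0\to\mathfrak X_{Ham}(M,\omega)/\ker(\iota_\bullet\omega)$,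 and $[\alpha]\mapsto[(0,\alpha)]$ identifies $H^{n-1}_{dR}(M)$ with the kernel of $\bar\pi$. Let $\mathfrak g$ be a finite-dimensional real Lie algebra and let $\zeta:\mathfrak g\to\mathfrak X(M)$ be a weakly Hamiltonian infinitesimal action, i.e. a Lie algebra homomorphism for which there is a linear map $j:\mathfrak g\to L_0$ such that $j(X)$ has vector field component $\zeta(X)$ for all $X\in\mathfrak g$. Then $\zeta$ takes values in $\mathfrak X_{Ham}(M,\omega)$; let $\bar\zeta:\mathfrak g\to\mathfrak X_{Ham}(M,\omega)/\ker(\iota_\bullet\omega)$ be the induced map. Let $g_2\in\Lambda^2\mathfrak g^*\otimes\Omega^{n-1}(M)$ be given by $g_2(X,Y)=\iota_{\zeta(Y)}\iota_{\zeta(X)}\omega$, and let $q_\Lambda:\Lambda^2\mathfrak g^*\to\Lambda^2\mathfrak g^*/(\Lambda^2\mathfrak g^*)_{ex}$ and $q_\Omega:\Omega^{n-1}(M)\to\Omega^{n-1}(M)/\Omega^{n-1}_{ex}(M)$ be the projections, where $(\Lambda^2\mathfrak g^*)_{ex}$ is the space of Chevalley-Eilenberg coboundaries. The element $(q_\Lambda\otimes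 q_\Omega)(g_2)$ lies in the subspace $H^2(\mathfrak g)\otimes H^{n-1}_{dR}(M)$; as an element of this space it is denoted by $h_2$ and called the second obstruction class of $\zeta$. Then: 1. There is a Lie algebra homomorphism $f:\mathfrak g\to\bar L_0$ with $\bar\pi\circ f=\bar\zeta$ (i.e. the dual of a covariant multimomentum map in the sense of Cariñena, Crampin and Ibort) if and only if $h_2=0$. 2. For every linear map $\bar j:\mathfrak g\to\bar L_0$ with $\bar\pi\circ\bar j=\bar\zeta$, the map $\bar c(X,Y)=\bar l_2(\bar j(X),\bar j(Y))-\bar j([X,Y])$ is a 2-cocycle with values in $H^{n-1}_{dR}(M)$, i.e. comes from a unique element of $Z^2(\mathfrak g)\otimes H^{n-1}_{dR}(M)$, where $Z^2(\mathfrak g)\subset\Lambda^2\mathfrak g^*$ is the space of cocycles, and its class in $H^2(\mathfrak g)\otimes H^{n-1}_{dR}(M)$ is $[\bar c]_{CE}=h_2$. -/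

import Mathlib

open scoped Manifold ContDiff Topology

namespace Multisymplectic

section Local
variable {E : Type*} [NormedAddCommGroup E] [NormedSpace ℝ E]

/-- The isometry `curryLeft`, as a continuous linear map. -/
noncomputable def curryCLM (k : ℕ) : (E [⋀^Fin (k + 1)]→L[ℝ] ℝ) →L[ℝ] (E →L[ℝ] E [⋀^Fin k]→L[ℝ] ℝ) :=
  (ContinuousAlternatingMap.curryLeftLI (𝕜 := ℝ) (E := E) (F := ℝ) (n := k)).toContinuousLinearMap

lemma curryCLM_apply {k : ℕ} (f : E [⋀^Fin (k + 1)]→L[ℝ] ℝ) : curryCLM k f = f.curryLeft := rfl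

lemma hasFDerivAt_curryLeft {k : ℕ} {α : E → E [⋀^Fin (k + 1)]→L[ℝ] ℝ} {x : E}
    (hα : DifferentiableAt ℝ α x) :
    HasFDerivAt (fun y => (α y).curryLeft) ((curryCLM k).comp (fderiv ℝ α x)) x := by
  have h := ContinuousLinearMap.hasFDerivAt (𝕜 := ℝ) (x := α x) (E := E [⋀^Fin (k + 1)]→L[ℝ] ℝ)
    (F := E →L[ℝ] E [⋀^Fin k]→L[ℝ] ℝ) (curryCLM k)
  exact HasFDerivAt.comp (g := curryCLM k) x h hα.hasFDerivAt

lemma contDiffOn_curryLeft_apply {k : ℕ} {α : E → E [⋀^Fin (k + 1)]→L[ℝ] ℝ} {V : E → E}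
    {s : Set E} {r : WithTop ℕ∞} (hα : ContDiffOn ℝ r α s) (hV : ContDiffOn ℝ r V s) :
    ContDiffOn ℝ r (fun y => (α y).curryLeft (V y)) s := by
  have h := ContinuousLinearMap.contDiff (𝕜 := ℝ) (n := r) (E := E [⋀^Fin (k + 1)]→L[ℝ] ℝ)
    (F := E →L[ℝ] E [⋀^Fin k]→L[ℝ] ℝ) (curryCLM k)
  have h2 : ContDiffOn ℝ r (fun y => (α y).curryLeft) s :=
    ContDiff.comp_contDiffOn (g := curryCLM k) h hα
  exact h2.clm_apply hV

lemma differentiableAt_curryLeft_apply {k : ℕ} {α : E → E [⋀^Fin (k + 1)]→L[ℝ] ℝ} {V : E → E}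
    {x : E} (hα : DifferentiableAt ℝ α x) (hV : DifferentiableAt ℝ V x) :
    DifferentiableAt ℝ (fun y => (α y).curryLeft (V y)) x :=
  (hasFDerivAt_curryLeft hα).differentiableAt.clm_apply hV

lemma fderiv_curryLeft_apply {k : ℕ} {α : E → E [⋀^Fin (k + 1)]→L[ℝ] ℝ} {V : E → E} {x : E}
    (hα : DifferentiableAt ℝ α x) (hV : DifferentiableAt ℝ V x) (a : E) :
    fderiv ℝ (fun y => (α y).curryLeft (V y)) x a =
      (fderiv ℝ α x a).curryLeft (V x) + (α x).curryLeft (fderiv ℝ V x a) := by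
  have := ((hasFDerivAt_curryLeft hα).clm_apply hV.hasFDerivAt).fderiv
  rw [this]
  simp [curryCLM_apply, add_comm]

lemma cartan_aux {k : ℕ} {α : E → E [⋀^Fin (k + 1)]→L[ℝ] ℝ} {V : E → E} {x : E}
    (hα : DifferentiableAt ℝ α x) (hV : DifferentiableAt ℝ V x) (u : Fin (k + 1) → E) :
    extDeriv (fun y => (α y).curryLeft (V y)) x u + extDeriv α x (Matrix.vecCons (V x) u) =
      fderiv ℝ α x (V x) u +
        ∑ i, (-1) ^ i.val • α x (Matrix.vecCons (fderiv ℝ V x (u i)) (i.removeNth u)) := by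
  have hd := fderiv_curryLeft_apply hα hV
  simp only [extDeriv, ContinuousAlternatingMap.alternatizeUncurryFin_apply, hd]
  rw [Fin.sum_univ_succ (n := k + 1)]
  simp only [ContinuousAlternatingMap.add_apply, smul_add, Finset.sum_add_distrib,
    ContinuousAlternatingMap.curryLeft_apply_apply, Matrix.cons_val_succ, Fin.val_zero, pow_zero,
    one_smul, Matrix.cons_val_zero, Fin.val_succ, pow_succ]
  have h0 : (0 : Fin (k + 2)).removeNth (Matrix.vecCons (V x) u) = u := by
    ext i; simp [Fin.removeNth]
  have h1 : ∀ i : Fin (k + 1), i.succ.removeNth (Matrix.vecCons (V x) u) =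
      Matrix.vecCons (V x) (i.removeNth u) := by
    intro i; ext j; cases j using Fin.cases <;> simp [Fin.removeNth]
  simp only [h0, h1, mul_neg, mul_one, neg_smul, Finset.sum_neg_distrib]
  ring

lemma lieBracket_curryLeft {k : ℕ} {α : E → E [⋀^Fin (k + 2)]→L[ℝ] ℝ} {V W : E → E} {x : E}
    (hα : DifferentiableAt ℝ α x) (hV : DifferentiableAt ℝ V x) (hW : DifferentiableAt ℝ W x) :
    (α x).curryLeft (VectorField.lieBracket ℝ V W x) =
      extDeriv (fun y => ((α y).curryLeft (W y)).curryLeft (V y)) x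
      + (extDeriv (fun y => (α y).curryLeft (W y)) x).curryLeft (V x)
      - (extDeriv (fun y => (α y).curryLeft (V y)) x).curryLeft (W x)
      - ((extDeriv α x).curryLeft (V x)).curryLeft (W x) := by
  have hd := fderiv_curryLeft_apply hα hW
  ext u
  have A := cartan_aux (α := fun y => (α y).curryLeft (W y)) (V := V) (differentiableAt_curryLeft_apply hα hW) hV u
  have B := cartan_aux hα hV (Matrix.vecCons (W x) u)
  simp only [ContinuousAlternatingMap.add_apply, ContinuousAlternatingMap.sub_apply,
    ContinuousAlternatingMap.curryLeft_apply_apply]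
  rw [Fin.sum_univ_succ] at B
  have h0 : (0 : Fin (k + 2)).removeNth (Matrix.vecCons (W x) u) = u := by
    ext i; simp [Fin.removeNth]
  have h1 : ∀ i : Fin (k + 1), i.succ.removeNth (Matrix.vecCons (W x) u) =
      Matrix.vecCons (W x) (i.removeNth u) := by
    intro i; ext j; cases j using Fin.cases <;> simp [Fin.removeNth]
  have hs : ∀ a b : E, ∀ c : Fin k → E, α x (Matrix.vecCons a (Matrix.vecCons b c)) =
      - α x (Matrix.vecCons b (Matrix.vecCons a c)) := by
    intro a b c
    have h := (α x).toAlternatingMap.map_swap (Matrix.vecCons a (Matrix.vecCons b c))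
      (i := 0) (j := 1) (by simp)
    have e : (Matrix.vecCons a (Matrix.vecCons b c)) ∘ (Equiv.swap (0 : Fin (k + 2)) 1) =
        Matrix.vecCons b (Matrix.vecCons a c) := by
      ext i
      refine Fin.cases ?_ (fun i => Fin.cases ?_ (fun i => ?_) i) i
      · simp
      · simp
      · have e1 : Equiv.swap (0 : Fin (k + 2)) 1 i.succ.succ = i.succ.succ :=
          Equiv.swap_apply_of_ne_of_ne (by simp) (by simp [Fin.ext_iff])
        simp only [Function.comp, e1]; simp
    rw [e] at h
    simp only [ContinuousAlternatingMap.coe_toAlternatingMap] at h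
    linarith
  simp only [h0, h1, hd, ContinuousAlternatingMap.add_apply, 
    ContinuousAlternatingMap.curryLeft_apply_apply, Matrix.cons_val_succ, Fin.val_zero, pow_zero,
    one_smul, Matrix.cons_val_zero, Fin.val_succ, pow_succ, mul_neg, mul_one, neg_smul,
    Finset.sum_neg_distrib] at A B
  have hS : ∑ i : Fin (k+1), (-1) ^ i.val • α x (Matrix.vecCons (W x) (Matrix.vecCons (fderiv ℝ V x (u i)) (i.removeNth u))) =
    - ∑ i : Fin (k+1), (-1) ^ i.val • α x (Matrix.vecCons (fderiv ℝ V x (u i)) (Matrix.vecCons (W x) (i.removeNth u))) := by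
    rw [← Finset.sum_neg_distrib]
    refine Finset.sum_congr rfl fun i _ => ?_
    rw [hs, smul_neg]
  have hL : α x (Matrix.vecCons (VectorField.lieBracket ℝ V W x) u) =
      α x (Matrix.vecCons (fderiv ℝ W x (V x)) u) - α x (Matrix.vecCons (fderiv ℝ V x (W x)) u) := by
    simp [VectorField.lieBracket]
  rw [hL]
  linarith

lemma lieBracket_curryLeft_one {α : E → E [⋀^Fin 1]→L[ℝ] ℝ} {V W : E → E} {x : E}
    (hα : DifferentiableAt ℝ α x) (hV : DifferentiableAt ℝ V x) (hW : DifferentiableAt ℝ W x) :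
    (α x).curryLeft (VectorField.lieBracket ℝ V W x) =
      (extDeriv (fun y => (α y).curryLeft (W y)) x).curryLeft (V x)
      - (extDeriv (fun y => (α y).curryLeft (V y)) x).curryLeft (W x)
      - ((extDeriv α x).curryLeft (V x)).curryLeft (W x) := by
  have hd := fderiv_curryLeft_apply hα hW
  ext u
  have B := cartan_aux hα hV (Matrix.vecCons (W x) u)
  have hL : α x (Matrix.vecCons (VectorField.lieBracket ℝ V W x) u) =
      α x (Matrix.vecCons (fderiv ℝ W x (V x)) u) - α x (Matrix.vecCons (fderiv ℝ V x (W x)) u) := by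
    simp [VectorField.lieBracket]
  have A : extDeriv (fun y => (α y).curryLeft (W y)) x (Matrix.vecCons (V x) u) =
      fderiv ℝ (fun y => (α y).curryLeft (W y)) x (V x) u := by
    simp [extDeriv, ContinuousAlternatingMap.alternatizeUncurryFin_apply]
  have h0 : (0 : Fin 1).removeNth (Matrix.vecCons (W x) u) = u := by
    ext i; exact i.elim0
  simp only [hd, ContinuousAlternatingMap.add_apply, ContinuousAlternatingMap.curryLeft_apply_apply]
    at A
  simp [h0] at B
  simp only [ContinuousAlternatingMap.sub_apply, ContinuousAlternatingMap.curryLeft_apply_apply]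
  rw [hL, A]
  linarith
end Local


section Forms
set_option linter.unusedSectionVars false
set_option linter.unusedVariables false

lemma two_le_infty : (2 : WithTop ℕ∞) ≤ ∞ :=
  WithTop.coe_le_coe.2 (le_top : (2 : ℕ∞) ≤ ⊤)
lemma three_le_infty : (3 : WithTop ℕ∞) ≤ ∞ :=
  WithTop.coe_le_coe.2 (le_top : (3 : ℕ∞) ≤ ⊤)
variable (E : Type*) [NormedAddCommGroup E] [NormedSpace ℝ E] (M : Type*) [TopologicalSpace M]
  [ChartedSpace E M]

/-- Not necessarily smooth sections of `Λ^k T^*M`. -/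
abbrev RoughForm (k : ℕ) := ∀ x : M, TangentSpace 𝓘(ℝ, E) x [⋀^Fin k]→L[ℝ] ℝ

variable {E M}

/-- The differential at `y` of the inverse of the preferred chart at `x₀`. -/
noncomputable def symmD (x₀ : M) (y : E) :
    E →L[ℝ] TangentSpace 𝓘(ℝ, E) ((extChartAt 𝓘(ℝ, E) x₀).symm y) :=
  mfderiv 𝓘(ℝ, E) 𝓘(ℝ, E) (extChartAt 𝓘(ℝ, E) x₀).symm y

/-- The differential at `x` of the preferred chart at `x₀`. -/
noncomputable def chartD (x₀ x : M) : TangentSpace 𝓘(ℝ, E) x →L[ℝ] E :=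
  mfderiv 𝓘(ℝ, E) 𝓘(ℝ, E) (extChartAt 𝓘(ℝ, E) x₀) x

/-- The expression of a form in the preferred chart at `x₀`, i.e. its pullback along the inverse of
this chart. -/
noncomputable def chartRep {k : ℕ} (α : RoughForm E M k) (x₀ : M) (y : E) : E [⋀^Fin k]→L[ℝ] ℝ :=
  (α ((extChartAt 𝓘(ℝ, E) x₀).symm y)).compContinuousLinearMap (symmD x₀ y)

/-- The exterior derivative, computed at each point `x` in the preferred chart at `x`. -/
noncomputable def roughD {k : ℕ} (α : RoughForm E M k) : RoughForm E M (k + 1) := fun x =>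
  (extDeriv (chartRep α x) (extChartAt 𝓘(ℝ, E) x x)).compContinuousLinearMap (chartD x x)

/-- Contraction `(ι_v α)_x (u₁, …, u_k) = α_x (v x, u₁, …, u_k)`. -/
noncomputable def roughContract {k : ℕ} (v : ∀ x : M, TangentSpace 𝓘(ℝ, E) x)
    (α : RoughForm E M (k + 1)) : RoughForm E M k := fun x =>
  ContinuousAlternatingMap.curryLeft (E := E) (α x) (v x)

/-- A vector field in the preferred chart at `x₀`. -/
noncomputable def fieldRep (v : ∀ x : M, TangentSpace 𝓘(ℝ, E) x) (x₀ : M) (y : E) : E :=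
  VectorField.mpullback 𝓘(ℝ, E) 𝓘(ℝ, E) (extChartAt 𝓘(ℝ, E) x₀).symm v y

variable [IsManifold 𝓘(ℝ, E) ∞ M]

lemma isOpen_target (x₀ : M) : IsOpen (extChartAt 𝓘(ℝ, E) x₀).target :=
  isOpen_extChartAt_target x₀

lemma chartD_comp_symmD {x₀ : M} {y : E} (hy : y ∈ (extChartAt 𝓘(ℝ, E) x₀).target) :
    (chartD x₀ ((extChartAt 𝓘(ℝ, E) x₀).symm y)).comp (symmD x₀ y) = ContinuousLinearMap.id ℝ E := by
  have : IsManifold 𝓘(ℝ, E) 1 M := IsManifold.of_le (n := ∞) (by simp)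
  have h := mfderiv_extChartAt_comp_mfderivWithin_extChartAt_symm (I := 𝓘(ℝ, E)) hy
  rwa [modelWithCornersSelf_coe, Set.range_id, mfderivWithin_univ] at h

lemma symmD_comp_chartD {x₀ : M} {y : E} (hy : y ∈ (extChartAt 𝓘(ℝ, E) x₀).target) :
    (symmD x₀ y).comp (chartD x₀ ((extChartAt 𝓘(ℝ, E) x₀).symm y)) =
      ContinuousLinearMap.id ℝ (TangentSpace 𝓘(ℝ, E) ((extChartAt 𝓘(ℝ, E) x₀).symm y)) := by
  have : IsManifold 𝓘(ℝ, E) 1 M := IsManifold.of_le (n := ∞) (by simp)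
  have h := mfderivWithin_extChartAt_symm_comp_mfderiv_extChartAt (I := 𝓘(ℝ, E)) hy
  rwa [modelWithCornersSelf_coe, Set.range_id, mfderivWithin_univ] at h

lemma contMDiffAt_symm {x₀ : M} {y : E} (hy : y ∈ (extChartAt 𝓘(ℝ, E) x₀).target) :
    ContMDiffAt 𝓘(ℝ, E) 𝓘(ℝ, E) ∞ (extChartAt 𝓘(ℝ, E) x₀).symm y :=
  (contMDiffOn_extChartAt_symm x₀).contMDiffAt ((isOpen_target x₀).mem_nhds hy)

/-- The transition map between preferred charts. -/
noncomputable def trans (x₁ x₀ : M) (y : E) : E :=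
  extChartAt 𝓘(ℝ, E) x₁ ((extChartAt 𝓘(ℝ, E) x₀).symm y)

lemma contDiffAt_trans {x₁ x₀ : M} {y : E} (hy : y ∈ (extChartAt 𝓘(ℝ, E) x₀).target)
    (hy' : (extChartAt 𝓘(ℝ, E) x₀).symm y ∈ (extChartAt 𝓘(ℝ, E) x₁).source) :
    ContDiffAt ℝ ∞ (trans x₁ x₀ : E → E) y := by
  have h1 := contMDiffAt_symm hy
  have h2 : ContMDiffAt 𝓘(ℝ, E) 𝓘(ℝ, E) ∞ (extChartAt 𝓘(ℝ, E) x₁)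
      ((extChartAt 𝓘(ℝ, E) x₀).symm y) := contMDiffAt_extChartAt' (by simpa using hy')
  exact (h2.comp y h1).contDiffAt

lemma fderiv_trans {x₁ x₀ : M} {y : E} (hy : y ∈ (extChartAt 𝓘(ℝ, E) x₀).target)
    (hy' : (extChartAt 𝓘(ℝ, E) x₀).symm y ∈ (extChartAt 𝓘(ℝ, E) x₁).source) :
    fderiv ℝ (trans x₁ x₀ : E → E) y =
      (chartD x₁ ((extChartAt 𝓘(ℝ, E) x₀).symm y)).comp (symmD x₀ y) := by
  have h1 := contMDiffAt_symm hy
  have h2 : ContMDiffAt 𝓘(ℝ, E) 𝓘(ℝ, E) ∞ (extChartAt 𝓘(ℝ, E) x₁)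
      ((extChartAt 𝓘(ℝ, E) x₀).symm y) := contMDiffAt_extChartAt' (by simpa using hy')
  have h := mfderiv_comp y (h2.mdifferentiableAt (by simp)) (h1.mdifferentiableAt (by simp))
  rw [mfderiv_eq_fderiv] at h
  exact h

lemma chartRep_apply {k : ℕ} (α : RoughForm E M k) (x₀ : M) (y : E) (u : Fin k → E) :
    chartRep α x₀ y u = α ((extChartAt 𝓘(ℝ, E) x₀).symm y) (fun i => symmD x₀ y (u i)) := rfl

lemma apply_congr {k : ℕ} (α : RoughForm E M k) {x x' : M} (h : x = x') (u : Fin k → E) :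
    α x (fun i => (u i : TangentSpace 𝓘(ℝ, E) x)) =
      α x' (fun i => (u i : TangentSpace 𝓘(ℝ, E) x')) := by
  subst h; rfl

lemma symmD_trans {x₁ x₀ : M} {y : E} (hy : y ∈ (extChartAt 𝓘(ℝ, E) x₀).target)
    (hy' : (extChartAt 𝓘(ℝ, E) x₀).symm y ∈ (extChartAt 𝓘(ℝ, E) x₁).source) (u : E) :
    (symmD x₁ (trans x₁ x₀ y) (fderiv ℝ (trans x₁ x₀ : E → E) y u) : E) = (symmD x₀ y u : E) := by
  rw [fderiv_trans hy hy']
  have ht : trans x₁ x₀ y ∈ (extChartAt 𝓘(ℝ, E) x₁).target := (extChartAt _ x₁).map_source hy'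
  have h := symmD_comp_chartD ht
  have e : (extChartAt 𝓘(ℝ, E) x₁).symm (trans x₁ x₀ y) = (extChartAt 𝓘(ℝ, E) x₀).symm y :=
    (extChartAt _ x₁).left_inv hy'
  rw [e] at h
  exact congrArg (fun f => f (symmD x₀ y u)) h

lemma chartRep_trans {k : ℕ} (α : RoughForm E M k) {x₁ x₀ : M} {y : E}
    (hy : y ∈ (extChartAt 𝓘(ℝ, E) x₀).target)
    (hy' : (extChartAt 𝓘(ℝ, E) x₀).symm y ∈ (extChartAt 𝓘(ℝ, E) x₁).source) :
    chartRep α x₀ y = (chartRep α x₁ (trans x₁ x₀ y)).compContinuousLinearMap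
      (fderiv ℝ (trans x₁ x₀ : E → E) y) := by
  ext u
  have e : (extChartAt 𝓘(ℝ, E) x₁).symm (trans x₁ x₀ y) = (extChartAt 𝓘(ℝ, E) x₀).symm y :=
    (extChartAt _ x₁).left_inv hy'
  rw [chartRep_apply, ContinuousAlternatingMap.compContinuousLinearMap_apply, chartRep_apply]
  refine Eq.trans ?_ (apply_congr α e _).symm
  congr 1
  funext i
  exact (symmD_trans hy hy' (u i)).symm

variable (E M) in
/-- The sections of `Λ^k T^*M` whose expressions in charts are smooth. -/
noncomputable def smoothForms (k : ℕ) : Submodule ℝ (RoughForm E M k) where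
  carrier := {α | ∀ x₀ : M, ContDiffOn ℝ ∞ (chartRep α x₀) (extChartAt 𝓘(ℝ, E) x₀).target}
  add_mem' ha hb x₀ := (ha x₀).add (hb x₀)
  zero_mem' x₀ := contDiffOn_const (c := (0 : E [⋀^Fin k]→L[ℝ] ℝ))
  smul_mem' c _ ha x₀ := (ha x₀).const_smul c

variable (E M) in
/-- The space `Ω^k(M)` of smooth differential `k`-forms on `M`. -/
def DiffForm (k : ℕ) : Type _ := smoothForms E M k

noncomputable instance (k : ℕ) : AddCommGroup (DiffForm E M k) :=
  inferInstanceAs (AddCommGroup (smoothForms E M k))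

noncomputable instance (k : ℕ) : Module ℝ (DiffForm E M k) :=
  inferInstanceAs (Module ℝ (smoothForms E M k))

lemma DiffForm.ext {k : ℕ} {α β : DiffForm E M k} (h : α.1 = β.1) : α = β := Subtype.ext h

lemma trans_nhds {x₁ x₀ : M} {y : E} (hy : y ∈ (extChartAt 𝓘(ℝ, E) x₀).target)
    (hy' : (extChartAt 𝓘(ℝ, E) x₀).symm y ∈ (extChartAt 𝓘(ℝ, E) x₁).source) :
    ∀ᶠ z in 𝓝 y, z ∈ (extChartAt 𝓘(ℝ, E) x₀).target ∧
      (extChartAt 𝓘(ℝ, E) x₀).symm z ∈ (extChartAt 𝓘(ℝ, E) x₁).source := by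
  have h1 := (isOpen_target x₀).mem_nhds hy
  have h2 : ContinuousAt (extChartAt 𝓘(ℝ, E) x₀).symm y := (contMDiffAt_symm hy).continuousAt
  exact Filter.Eventually.and h1 (h2 ((isOpen_extChartAt_source x₁).mem_nhds hy'))

lemma chartRep_roughD {k : ℕ} {α : RoughForm E M k} (hα : α ∈ smoothForms E M k) {x₀ : M} {y : E}
    (hy : y ∈ (extChartAt 𝓘(ℝ, E) x₀).target) :
    chartRep (roughD α) x₀ y = extDeriv (chartRep α x₀) y := by
  set x₁ := (extChartAt 𝓘(ℝ, E) x₀).symm y with hx₁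
  have hy' : (extChartAt 𝓘(ℝ, E) x₀).symm y ∈ (extChartAt 𝓘(ℝ, E) x₁).source :=
    mem_extChartAt_source x₁
  have h : chartRep α x₀ =ᶠ[𝓝 y] fun z => (chartRep α x₁ (trans x₁ x₀ z)).compContinuousLinearMap
      (fderiv ℝ (trans x₁ x₀ : E → E) z) := by
    filter_upwards [trans_nhds hy hy'] with z hz using chartRep_trans α hz.1 hz.2
  have ht : trans x₁ x₀ y ∈ (extChartAt 𝓘(ℝ, E) x₁).target := (extChartAt _ x₁).map_source hy'
  rw [h.extDeriv_eq, extDeriv_pullback (r := ∞) _ (contDiffAt_trans hy hy') (by simpa using two_le_infty),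
    fderiv_trans hy hy']
  · rfl
  · exact ((hα x₁).contDiffAt ((isOpen_target x₁).mem_nhds ht)).differentiableAt (by simp)

lemma form_ext {k : ℕ} {α β : RoughForm E M k}
    (h : ∀ (x₀ : M), ∀ y ∈ (extChartAt 𝓘(ℝ, E) x₀).target, chartRep α x₀ y = chartRep β x₀ y) :
    α = β := by
  funext x
  have hx := h x _ (mem_extChartAt_target x)
  ext u
  have := congrArg (fun f => f (fun i => chartD x x (u i))) hx
  have e : (extChartAt 𝓘(ℝ, E) x).symm (extChartAt 𝓘(ℝ, E) x x) = x := extChartAt_to_inv x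
  have hs : ∀ v : E, (symmD x (extChartAt 𝓘(ℝ, E) x x) (chartD x x v) : E) = v := by
    intro v
    have h := symmD_comp_chartD (mem_extChartAt_target (I := 𝓘(ℝ, E)) x)
    rw [e] at h
    exact congrArg (fun f => f v) h
  have key : ∀ γ : RoughForm E M k, chartRep γ x (extChartAt 𝓘(ℝ, E) x x)
      (fun i => chartD x x (u i)) = γ x u := by
    intro γ
    rw [chartRep_apply]
    refine Eq.trans ?_ (apply_congr γ e u)
    congr 1
    funext i
    exact hs (u i)
  rw [← key α, ← key β]
  exact this

lemma contDiffOn_extDeriv {k : ℕ} {f : E → E [⋀^Fin k]→L[ℝ] ℝ} {s : Set E} (hs : IsOpen s)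
    (hf : ContDiffOn ℝ ∞ f s) : ContDiffOn ℝ ∞ (extDeriv f) s := by
  have h1 : ContDiffOn ℝ ∞ (fderiv ℝ f) s := hf.fderiv_of_isOpen hs (by simp)
  have h := ContinuousLinearMap.contDiff (𝕜 := ℝ) (n := ∞) (E := E →L[ℝ] E [⋀^Fin k]→L[ℝ] ℝ)
    (F := E [⋀^Fin (k + 1)]→L[ℝ] ℝ) (ContinuousAlternatingMap.alternatizeUncurryFinCLM ℝ E ℝ)
  exact ContDiff.comp_contDiffOn
    (g := ContinuousAlternatingMap.alternatizeUncurryFinCLM ℝ E ℝ) h h1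

lemma roughD_mem {k : ℕ} {α : RoughForm E M k} (hα : α ∈ smoothForms E M k) :
    roughD α ∈ smoothForms E M (k + 1) := fun x₀ =>
  (contDiffOn_extDeriv (isOpen_target x₀) (hα x₀)).congr fun _ hy => chartRep_roughD hα hy

lemma chartRep_differentiableAt {k : ℕ} {α : RoughForm E M k} (hα : α ∈ smoothForms E M k) {x₀ : M}
    {y : E} (hy : y ∈ (extChartAt 𝓘(ℝ, E) x₀).target) : DifferentiableAt ℝ (chartRep α x₀) y :=
  ((hα x₀).contDiffAt ((isOpen_target x₀).mem_nhds hy)).differentiableAt (by simp)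

/-- The exterior derivative `d : Ω^k(M) → Ω^{k+1}(M)`. -/
noncomputable def d (k : ℕ) : DiffForm E M k →ₗ[ℝ] DiffForm E M (k + 1) where
  toFun α := ⟨roughD α.1, roughD_mem α.2⟩
  map_add' α β := by
    apply DiffForm.ext
    refine form_ext fun x₀ y hy => ?_
    rw [chartRep_roughD (α + β).2 hy]
    change _ = chartRep (roughD α.1) x₀ y + chartRep (roughD β.1) x₀ y
    rw [chartRep_roughD α.2 hy, chartRep_roughD β.2 hy]
    exact extDeriv_add (chartRep_differentiableAt α.2 hy) (chartRep_differentiableAt β.2 hy)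
  map_smul' c α := by
    apply DiffForm.ext
    refine form_ext fun x₀ y hy => ?_
    rw [chartRep_roughD (c • α).2 hy]
    change _ = c • chartRep (roughD α.1) x₀ y
    rw [chartRep_roughD α.2 hy]
    exact extDeriv_smul (𝕜 := ℝ) (E := E) (F := ℝ) (x := y) c (chartRep α.1 x₀)

lemma d_d {k : ℕ} (α : DiffForm E M k) : d (k + 1) (d k α) = 0 := by
  apply DiffForm.ext
  refine form_ext fun x₀ y hy => ?_
  change chartRep (roughD (roughD α.1)) x₀ y = 0
  rw [chartRep_roughD (roughD_mem α.2) hy]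
  have : chartRep (roughD α.1) x₀ =ᶠ[𝓝 y] extDeriv (chartRep α.1 x₀) := by
    filter_upwards [(isOpen_target x₀).mem_nhds hy] with z hz using chartRep_roughD α.2 hz
  rw [this.extDeriv_eq]
  exact extDeriv_extDeriv_apply (r := ∞) ((α.2 x₀).contDiffAt ((isOpen_target x₀).mem_nhds hy))
    (by simpa using two_le_infty)

variable (E M) in
/-- Smooth vector fields on `M`. -/
abbrev VF := Cₛ^∞⟮𝓘(ℝ, E); E, (TangentSpace 𝓘(ℝ, E) : M → Type _)⟯

variable [FiniteDimensional ℝ E]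

lemma contDiffOn_fieldRep (v : VF E M) (x₀ : M) :
    ContDiffOn ℝ ∞ (fieldRep (fun x => v x) x₀) (extChartAt 𝓘(ℝ, E) x₀).target := by
  have : CompleteSpace E := FiniteDimensional.complete ℝ E
  intro y hy
  apply ContDiffAt.contDiffWithinAt
  have hi : (symmD x₀ y).IsInvertible :=
    ContinuousLinearMap.IsInvertible.of_inverse (symmD_comp_chartD hy) (chartD_comp_symmD hy)
  have h := ContMDiffAt.mpullback_vectorField_preimage (n := ∞) (m := ∞) (I := 𝓘(ℝ, E)) (I' := 𝓘(ℝ, E))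
    (V := fun x => v x) (v.contMDiff _) (contMDiffAt_symm hy)
    hi (by simp)
  exact contMDiffAt_vectorSpace_iff_contDiffAt.1 h

lemma fieldRep_differentiableAt (v : VF E M) {x₀ : M} {y : E}
    (hy : y ∈ (extChartAt 𝓘(ℝ, E) x₀).target) :
    DifferentiableAt ℝ (fieldRep (fun x => v x) x₀) y :=
  ((contDiffOn_fieldRep v x₀).contDiffAt ((isOpen_target x₀).mem_nhds hy)).differentiableAt
    (by simp)

lemma symmD_fieldRep (v : ∀ x : M, TangentSpace 𝓘(ℝ, E) x) {x₀ : M} {y : E}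
    (hy : y ∈ (extChartAt 𝓘(ℝ, E) x₀).target) :
    symmD x₀ y (fieldRep v x₀ y) = v ((extChartAt 𝓘(ℝ, E) x₀).symm y) := by
  have : (symmD x₀ y).inverse = chartD x₀ ((extChartAt 𝓘(ℝ, E) x₀).symm y) :=
    ContinuousLinearMap.inverse_eq (symmD_comp_chartD hy) (chartD_comp_symmD hy)
  change symmD x₀ y ((symmD x₀ y).inverse _) = _
  rw [this]
  exact congrArg (fun f : _ →L[ℝ] TangentSpace 𝓘(ℝ, E) _ => f _) (symmD_comp_chartD hy)

lemma chartRep_roughContract {k : ℕ} (v : ∀ x : M, TangentSpace 𝓘(ℝ, E) x)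
    (α : RoughForm E M (k + 1)) {x₀ : M} {y : E} (hy : y ∈ (extChartAt 𝓘(ℝ, E) x₀).target) :
    chartRep (roughContract v α) x₀ y = (chartRep α x₀ y).curryLeft (fieldRep v x₀ y) := by
  ext u
  rw [ContinuousAlternatingMap.curryLeft_apply_apply, chartRep_apply, chartRep_apply]
  change α _ _ = α _ _
  congr 1
  funext i
  refine Fin.cases ?_ (fun i => ?_) i
  · exact (symmD_fieldRep v hy).symm
  · rfl

/-- Contraction of a form with a vector field, as a bilinear map. -/
noncomputable def contract (k : ℕ) : VF E M →ₗ[ℝ] DiffForm E M (k + 1) →ₗ[ℝ] DiffForm E M k :=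
  LinearMap.mk₂ ℝ (fun v α => ⟨roughContract (fun x => v x) α.1, fun x₀ =>
    (contDiffOn_curryLeft_apply (α.2 x₀) (contDiffOn_fieldRep v x₀)).congr
      fun _ hy => chartRep_roughContract _ _ hy⟩)
    (fun v w α => by
      apply DiffForm.ext; funext x
      exact (ContinuousAlternatingMap.curryLeft (E := E) (α.1 x)).map_add (v x) (w x))
    (fun c v α => by
      apply DiffForm.ext; funext x
      exact (ContinuousAlternatingMap.curryLeft (E := E) (α.1 x)).map_smul c (v x))
    (fun _ _ _ => rfl) (fun _ _ _ => rfl)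

lemma contract_anticomm {k : ℕ} (v w : VF E M) (α : DiffForm E M (k + 2)) :
    contract k v (contract (k + 1) w α) = - contract k w (contract (k + 1) v α) := by
  have h : ∀ v : VF E M, contract k v (contract (k + 1) v α) = 0 := fun v => by
    apply DiffForm.ext; funext x
    exact ContinuousAlternatingMap.curryLeft_same (E := E) (α.1 x) (v x)
  have := h (v + w)
  simp only [map_add, LinearMap.add_apply, h, zero_add, add_zero] at this
  exact eq_neg_of_add_eq_zero_right this

noncomputable instance : Bracket (VF E M) (VF E M) where
  bracket v w := ⟨VectorField.mlieBracket 𝓘(ℝ, E) (fun x => v x) (fun x => w x), by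
    have : CompleteSpace E := FiniteDimensional.complete ℝ E
    have : IsManifold 𝓘(ℝ, E) (((⊤ : ℕ∞) : WithTop ℕ∞) + 1) M := inferInstanceAs (IsManifold 𝓘(ℝ, E) ∞ M)
    have : IsManifold 𝓘(ℝ, E) (minSmoothness ℝ 2) M :=
      IsManifold.of_le (n := ∞) (by simpa using two_le_infty)
    exact fun x => ContMDiffAt.mlieBracket_vectorField (n := ⊤) (m := ⊤) (v.contMDiff x) (w.contMDiff x) (by simp)⟩

lemma bracket_apply (v w : VF E M) (x : M) :
    ⁅v, w⁆ x = VectorField.mlieBracket 𝓘(ℝ, E) (fun x => v x) (fun x => w x) x := rfl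

lemma VF.mdiff (v : VF E M) (x : M) :
    MDifferentiableAt 𝓘(ℝ, E) 𝓘(ℝ, E).tangent
      (fun x => (⟨x, v x⟩ : TangentBundle 𝓘(ℝ, E) M)) x :=
  (v.contMDiff x).mdifferentiableAt (by simp)

/-- The Lie algebra `𝔛(M)` of smooth vector fields. -/
noncomputable instance : LieRing (VF E M) where
  add_lie u v w := by
    have : CompleteSpace E := FiniteDimensional.complete ℝ E
    ext x; exact VectorField.mlieBracket_add_left (u.mdiff x) (v.mdiff x)
  lie_add u v w := by
    have : CompleteSpace E := FiniteDimensional.complete ℝ E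
    ext x; exact VectorField.mlieBracket_add_right (v.mdiff x) (w.mdiff x)
  lie_self v := by
    ext x; exact congrFun VectorField.mlieBracket_self x
  leibniz_lie u v w := by
    have : CompleteSpace E := FiniteDimensional.complete ℝ E
    have : IsManifold 𝓘(ℝ, E) (minSmoothness ℝ 3) M :=
      IsManifold.of_le (n := ∞) (by simpa using three_le_infty)
    ext x
    exact VectorField.leibniz_identity_mlieBracket_apply ((u.contMDiff x).of_le (by simpa using two_le_infty))
      ((v.contMDiff x).of_le (by simpa using two_le_infty)) ((w.contMDiff x).of_le (by simpa using two_le_infty))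

noncomputable instance : LieAlgebra ℝ (VF E M) where
  lie_smul c v w := by
    have : CompleteSpace E := FiniteDimensional.complete ℝ E
    ext x; exact VectorField.mlieBracket_const_smul_right (w.mdiff x)

lemma fieldRep_bracket (v w : VF E M) {x₀ : M} {y : E}
    (hy : y ∈ (extChartAt 𝓘(ℝ, E) x₀).target) :
    fieldRep (fun x => ⁅v, w⁆ x) x₀ y = VectorField.lieBracket ℝ (fieldRep (fun x => v x) x₀)
      (fieldRep (fun x => w x) x₀) y := by
  have : CompleteSpace E := FiniteDimensional.complete ℝ E
  have : IsManifold 𝓘(ℝ, E) (minSmoothness ℝ 2) M :=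
    IsManifold.of_le (n := ∞) (by simpa using two_le_infty)
  have h := VectorField.mpullback_mlieBracket (I := 𝓘(ℝ, E)) (I' := 𝓘(ℝ, E)) (n := ∞) (v.mdiff _)
    (w.mdiff _) (contMDiffAt_symm (x₀ := x₀) hy) (by simpa using two_le_infty)
  rw [← VectorField.mlieBracketWithin_univ (I := 𝓘(ℝ, E)) (M := E),
    VectorField.mlieBracketWithin_eq_lieBracketWithin] at h
  exact h.trans (congrFun VectorField.lieBracketWithin_univ y)

lemma chartRep_d {k : ℕ} (α : DiffForm E M k) {x₀ : M} {y : E}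
    (hy : y ∈ (extChartAt 𝓘(ℝ, E) x₀).target) :
    chartRep (d k α).1 x₀ y = extDeriv (chartRep α.1 x₀) y := chartRep_roughD α.2 hy

lemma chartRep_contract {k : ℕ} (v : VF E M) (α : DiffForm E M (k + 1)) {x₀ : M} {y : E}
    (hy : y ∈ (extChartAt 𝓘(ℝ, E) x₀).target) :
    chartRep (contract k v α).1 x₀ y =
      (chartRep α.1 x₀ y).curryLeft (fieldRep (fun x => v x) x₀ y) := chartRep_roughContract _ _ hy

lemma chartRep_d_contract {k : ℕ} (v : VF E M) (α : DiffForm E M (k + 1)) {x₀ : M} {y : E}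
    (hy : y ∈ (extChartAt 𝓘(ℝ, E) x₀).target) :
    chartRep (d k (contract k v α)).1 x₀ y =
      extDeriv (fun z => (chartRep α.1 x₀ z).curryLeft (fieldRep (fun x => v x) x₀ z)) y := by
  rw [chartRep_d _ hy]
  apply Filter.EventuallyEq.extDeriv_eq
  filter_upwards [(isOpen_target x₀).mem_nhds hy] with z hz using chartRep_contract v α hz

/-- `ι_[v,w] = [L_v, ι_w]` with `L_v = d ι_v + ι_v d`. -/
lemma contract_bracket {k : ℕ} (v w : VF E M) (α : DiffForm E M (k + 2)) :
    contract (k + 1) ⁅v, w⁆ α = d k (contract k v (contract (k + 1) w α))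
      + contract (k + 1) v (d (k + 1) (contract (k + 1) w α))
      - contract (k + 1) w (d (k + 1) (contract (k + 1) v α))
      - contract (k + 1) w (contract (k + 2) v (d (k + 2) α)) := by
  apply DiffForm.ext
  refine form_ext fun x₀ y hy => ?_
  change _ = chartRep (d k (contract k v (contract (k + 1) w α))).1 x₀ y
      + chartRep (contract (k + 1) v (d (k + 1) (contract (k + 1) w α))).1 x₀ y
      - chartRep (contract (k + 1) w (d (k + 1) (contract (k + 1) v α))).1 x₀ y
      - chartRep (contract (k + 1) w (contract (k + 2) v (d (k + 2) α))).1 x₀ y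
  have h0 : chartRep (d k (contract k v (contract (k + 1) w α))).1 x₀ y =
      extDeriv (fun z => ((chartRep α.1 x₀ z).curryLeft (fieldRep (fun x => w x) x₀ z)).curryLeft
        (fieldRep (fun x => v x) x₀ z)) y := by
    rw [chartRep_d_contract _ _ hy]
    apply Filter.EventuallyEq.extDeriv_eq
    filter_upwards [(isOpen_target x₀).mem_nhds hy] with z hz
    rw [chartRep_contract w α hz]
  rw [h0]
  simp only [chartRep_contract _ _ hy, chartRep_d_contract _ _ hy, chartRep_d _ hy,
    fieldRep_bracket v w hy]
  exact lieBracket_curryLeft (chartRep_differentiableAt α.2 hy) (fieldRep_differentiableAt v hy)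
    (fieldRep_differentiableAt w hy)

lemma contract_bracket_one (v w : VF E M) (α : DiffForm E M 1) :
    contract 0 ⁅v, w⁆ α = contract 0 v (d 0 (contract 0 w α))
      - contract 0 w (d 0 (contract 0 v α)) - contract 0 w (contract 1 v (d 1 α)) := by
  apply DiffForm.ext
  refine form_ext fun x₀ y hy => ?_
  change _ = chartRep (contract 0 v (d 0 (contract 0 w α))).1 x₀ y
      - chartRep (contract 0 w (d 0 (contract 0 v α))).1 x₀ y
      - chartRep (contract 0 w (contract 1 v (d 1 α))).1 x₀ y
  simp only [chartRep_contract _ _ hy, chartRep_d_contract _ _ hy, chartRep_d _ hy,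
    fieldRep_bracket v w hy]
  exact lieBracket_curryLeft_one (chartRep_differentiableAt α.2 hy) (fieldRep_differentiableAt v hy)
    (fieldRep_differentiableAt w hy)

end Forms

section Observables
set_option linter.unusedSectionVars false
variable {E : Type*} [NormedAddCommGroup E] [NormedSpace ℝ E] [FiniteDimensional ℝ E]
  {M : Type*} [TopologicalSpace M] [ChartedSpace E M] [IsManifold 𝓘(ℝ, E) ∞ M]

variable (E M) in
/-- Closed `k`-forms. -/
noncomputable def closedForms (k : ℕ) : Submodule ℝ (DiffForm E M k) := LinearMap.ker (d k)

variable (E M) in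
/-- Exact `k`-forms; the only exact `0`-form is `0`. -/
noncomputable def exactForms : (k : ℕ) → Submodule ℝ (DiffForm E M k)
  | 0 => ⊥
  | k + 1 => LinearMap.range (d k)

variable (E M) in
/-- De Rham cohomology `H^k_{dR}(M)`. -/
abbrev deRham (k : ℕ) : Type _ :=
  closedForms E M k ⧸ (exactForms E M k).submoduleOf (closedForms E M k)

lemma exact_le_closed (k : ℕ) : exactForms E M k ≤ closedForms E M k := by
  cases k with
  | zero => exact bot_le
  | succ k =>
    rintro _ ⟨α, rfl⟩
    exact d_d α

/-- The Lie derivative of a `(k+1)`-form along a vector field: `L_v α = d ι_v α + ι_v d α`. -/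
noncomputable def lieDeriv {k : ℕ} (v : VF E M) (α : DiffForm E M (k + 1)) : DiffForm E M (k + 1) :=
  d k (contract k v α) + contract (k + 1) v (d (k + 1) α)

variable {m : ℕ} (ϖ : closedForms E M (m + 2))

/-- The degree zero observables: the pairs `(v, α)` of a vector field and an `m`-form with
`dα = -ι_v ϖ`. -/
noncomputable def L0 : Submodule ℝ (VF E M × DiffForm E M m) where
  carrier := {p | d m p.2 = - contract (m + 1) p.1 ϖ.1}
  add_mem' {p q} hp hq := by
    simp only [Set.mem_ofPred_eq] at hp hq ⊢
    rw [Prod.snd_add, Prod.fst_add, map_add, hp, hq, map_add, LinearMap.add_apply, neg_add]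
  zero_mem' := by simp
  smul_mem' c p hp := by
    simp only [Set.mem_ofPred_eq] at hp ⊢
    rw [Prod.smul_snd, Prod.smul_fst, map_smul, hp, map_smul, LinearMap.smul_apply, smul_neg]

variable {ϖ}

lemma d_closed : d (m + 2) ϖ.1 = 0 := ϖ.2

lemma L0_d (p : L0 ϖ) : d m p.1.2 = - contract (m + 1) p.1.1 ϖ.1 := p.2

lemma d_contract_of_L0 (p : L0 ϖ) : d (m + 1) (contract (m + 1) p.1.1 ϖ.1) = 0 := by
  have := d_d p.1.2
  rw [L0_d, map_neg, neg_eq_zero] at this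
  exact this

lemma contract_bracket_of_closed {v w : VF E M} (hv : d (m + 1) (contract (m + 1) v ϖ.1) = 0)
    (hw : d (m + 1) (contract (m + 1) w ϖ.1) = 0) :
    d m (contract m w (contract (m + 1) v ϖ.1)) = - contract (m + 1) ⁅v, w⁆ ϖ.1 := by
  rw [contract_bracket, hv, hw, d_closed, contract_anticomm v w]
  simp

/-- `ι_u ι_{[v,w]} ϖ` summed cyclically is exact. -/
lemma jacobi_exact {u v w : VF E M} (hu : d (m + 1) (contract (m + 1) u ϖ.1) = 0)
    (hv : d (m + 1) (contract (m + 1) v ϖ.1) = 0)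
    (hw : d (m + 1) (contract (m + 1) w ϖ.1) = 0) :
    contract m u (contract (m + 1) ⁅v, w⁆ ϖ.1) + contract m v (contract (m + 1) ⁅w, u⁆ ϖ.1)
      + contract m w (contract (m + 1) ⁅u, v⁆ ϖ.1) ∈ exactForms E M m := by
  have huw := contract_bracket_of_closed hu hw
  have hvw := contract_bracket_of_closed hv hw
  have e1 : contract m w (contract (m + 1) ⁅u, v⁆ ϖ.1) =
    - contract m ⁅u, v⁆ (contract (m + 1) w ϖ.1) := contract_anticomm _ _ _
  have e2 : d m (contract m v (contract (m + 1) w ϖ.1)) = contract (m + 1) ⁅v, w⁆ ϖ.1 := by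
    rw [contract_anticomm, map_neg, hvw, neg_neg]
  have e3 : d m (contract m u (contract (m + 1) w ϖ.1)) = contract (m + 1) ⁅u, w⁆ ϖ.1 := by
    rw [contract_anticomm, map_neg, huw, neg_neg]
  have e4 : ⁅w, u⁆ = -⁅u, w⁆ := (lie_skew _ _).symm
  rw [e1, e4]
  cases m with
  | zero =>
    rw [contract_bracket_one, hw, e2, e3]
    have : contract 0 u (contract 1 ⁅v, w⁆ ϖ.1) + contract 0 v (contract 1 (-⁅u, w⁆) ϖ.1)
      + -(contract 0 u (contract (0 + 1) ⁅v, w⁆ ϖ.1) - contract 0 v (contract (0 + 1) ⁅u, w⁆ ϖ.1)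
        - contract 0 v (contract 1 u 0)) = 0 := by
      simp only [map_neg, LinearMap.neg_apply, map_zero]
      abel
    exact this ▸ Submodule.zero_mem _
  | succ m =>
    rw [contract_bracket u v (contract (m + 1 + 1) w ϖ.1), hw, e2, e3]
    refine ⟨-contract m u (contract (m + 1) v (contract (m + 2) w ϖ.1)), ?_⟩
    simp only [map_neg, LinearMap.neg_apply, map_zero]
    abel

/-- The bracket `l₂((v, α), (w, β)) = ([v, w], ι_w ι_v ϖ)` on degree zero observables. -/
noncomputable def l2 : L0 ϖ →ₗ[ℝ] L0 ϖ →ₗ[ℝ] L0 ϖ :=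
  LinearMap.mk₂ ℝ
    (fun p q => ⟨(⁅p.1.1, q.1.1⁆, contract m q.1.1 (contract (m + 1) p.1.1 ϖ.1)),
      contract_bracket_of_closed (d_contract_of_L0 p) (d_contract_of_L0 q)⟩)
    (fun p p' q => by ext1; simp)
    (fun c p q => by ext1; simp)
    (fun p q q' => by ext1; simp)
    (fun c p q => by ext1; simp)

variable (ϖ)

/-- The vector fields `v` with `ι_v ϖ = 0`. -/
noncomputable def kerContract : Submodule ℝ (VF E M) := LinearMap.ker ((contract (m + 1)).flip ϖ.1)

/-- The exact `m`-forms `α`, as the elements `(0, α)` of `L0`. -/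
noncomputable def exactPart : Submodule ℝ (L0 ϖ) :=
  (Submodule.prod ⊥ (exactForms E M m)).submoduleOf (L0 ϖ)

/-- The vector fields `v` with `ι_v ϖ = 0`, as the elements `(v, 0)` of `L0`. -/
noncomputable def kerPart : Submodule ℝ (L0 ϖ) :=
  (Submodule.prod (kerContract ϖ) ⊥).submoduleOf (L0 ϖ)

variable {ϖ}

lemma mem_kerContract {v : VF E M} : v ∈ kerContract ϖ ↔ contract (m + 1) v ϖ.1 = 0 := Iff.rfl

lemma mem_sup_iff {p : L0 ϖ} : p ∈ exactPart ϖ ⊔ kerPart ϖ ↔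
    p.1.1 ∈ kerContract ϖ ∧ p.1.2 ∈ exactForms E M m := by
  constructor
  · intro h
    have hle : exactPart ϖ ⊔ kerPart ϖ ≤
        (Submodule.prod (kerContract ϖ) (exactForms E M m)).submoduleOf (L0 ϖ) :=
      sup_le (Submodule.comap_mono (Submodule.prod_mono bot_le le_rfl))
        (Submodule.comap_mono (Submodule.prod_mono le_rfl bot_le))
    exact hle h
  · rintro ⟨h1, h2⟩
    have hd : d m p.1.2 = 0 := exact_le_closed m h2
    have a : ((0, p.1.2) : VF E M × DiffForm E M m) ∈ L0 ϖ := by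
      change d m p.1.2 = - contract (m + 1) 0 ϖ.1
      rw [hd]; simp
    have b : ((p.1.1, 0) : VF E M × DiffForm E M m) ∈ L0 ϖ := by
      change d m 0 = - contract (m + 1) p.1.1 ϖ.1
      rw [mem_kerContract.1 h1]; simp
    refine Submodule.mem_sup.2 ⟨⟨_, a⟩, ⟨rfl, h2⟩, ⟨_, b⟩, ⟨h1, rfl⟩, ?_⟩
    ext1
    simp

variable (ϖ) in
/-- The quotient of `L0` by `Ω^m_{ex}(M) ⊕ ker(ι_• ϖ)`. -/
def ObsQuot : Type _ := L0 ϖ ⧸ (exactPart ϖ ⊔ kerPart ϖ)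

noncomputable instance : AddCommGroup (ObsQuot ϖ) :=
  inferInstanceAs (AddCommGroup (L0 ϖ ⧸ (exactPart ϖ ⊔ kerPart ϖ)))

noncomputable instance : Module ℝ (ObsQuot ϖ) :=
  inferInstanceAs (Module ℝ (L0 ϖ ⧸ (exactPart ϖ ⊔ kerPart ϖ)))

variable (ϖ) in
/-- The quotient map. -/
noncomputable def ObsQuot.mk : L0 ϖ →ₗ[ℝ] ObsQuot ϖ := Submodule.mkQ (exactPart ϖ ⊔ kerPart ϖ)

lemma ObsQuot.mk_surjective : Function.Surjective (ObsQuot.mk ϖ) := Submodule.mkQ_surjective _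

lemma ObsQuot.mk_eq_zero {p : L0 ϖ} : ObsQuot.mk ϖ p = 0 ↔ p ∈ exactPart ϖ ⊔ kerPart ϖ :=
  Submodule.Quotient.mk_eq_zero _

variable (ϖ) in
/-- Linear maps on the quotient. -/
noncomputable def ObsQuot.lift {V : Type*} [AddCommGroup V] [Module ℝ V] (f : L0 ϖ →ₗ[ℝ] V)
    (hf : ∀ p ∈ exactPart ϖ ⊔ kerPart ϖ, f p = 0) : ObsQuot ϖ →ₗ[ℝ] V :=
  Submodule.liftQ (exactPart ϖ ⊔ kerPart ϖ) f hf

lemma ObsQuot.lift_mk {V : Type*} [AddCommGroup V] [Module ℝ V] (f : L0 ϖ →ₗ[ℝ] V)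
    (hf : ∀ p ∈ exactPart ϖ ⊔ kerPart ϖ, f p = 0) (p : L0 ϖ) :
    ObsQuot.lift ϖ f hf (ObsQuot.mk ϖ p) = f p := rfl

lemma l2_skew (p q : L0 ϖ) : l2 p q = - l2 q p := by
  apply Subtype.ext
  exact Prod.ext (lie_skew _ _).symm (contract_anticomm _ _ _)

lemma l2_mem {p q : L0 ϖ} (hq : q ∈ exactPart ϖ ⊔ kerPart ϖ) :
    l2 p q ∈ exactPart ϖ ⊔ kerPart ϖ := by
  have hq1 : contract (m + 1) q.1.1 ϖ.1 = 0 := mem_kerContract.1 (mem_sup_iff.1 hq).1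
  have h0 : contract m q.1.1 (contract (m + 1) p.1.1 ϖ.1) = 0 := by
    rw [contract_anticomm, hq1]; simp
  refine mem_sup_iff.2 ⟨mem_kerContract.2 ?_, ?_⟩
  · have := contract_bracket_of_closed (d_contract_of_L0 p) (d_contract_of_L0 q)
    rw [h0, map_zero] at this
    exact neg_eq_zero.1 this.symm
  · have : (l2 p q).1.2 = 0 := h0
    rw [this]
    exact Submodule.zero_mem _

variable (ϖ) in
/-- The bracket induced by `l₂` on the quotient. -/
noncomputable def l2bar : ObsQuot ϖ →ₗ[ℝ] ObsQuot ϖ →ₗ[ℝ] ObsQuot ϖ :=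
  ObsQuot.lift ϖ (LinearMap.flip (ObsQuot.lift ϖ (l2.compr₂ (ObsQuot.mk ϖ)).flip
    (fun q hq => by
      ext p
      exact ObsQuot.mk_eq_zero.2 (l2_mem hq))))
    (fun p hp => by
      ext x
      obtain ⟨q, rfl⟩ := ObsQuot.mk_surjective x
      change ObsQuot.mk ϖ (l2 p q) = 0
      rw [l2_skew, map_neg, ObsQuot.mk_eq_zero.2 (l2_mem hp), neg_zero])

lemma l2bar_mk (p q : L0 ϖ) :
    l2bar ϖ (ObsQuot.mk ϖ p) (ObsQuot.mk ϖ q) = ObsQuot.mk ϖ (l2 p q) := rfl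

lemma l2_self (p : L0 ϖ) : l2 p p = 0 := by
  have h : contract m p.1.1 (contract (m + 1) p.1.1 ϖ.1) = 0 := by
    apply DiffForm.ext; funext x
    exact ContinuousAlternatingMap.curryLeft_same (E := E) (ϖ.1.1 x) (p.1.1 x)
  exact Subtype.ext (Prod.ext (lie_self _) h)

lemma l2_leibniz (p q r : L0 ϖ) :
    l2 p (l2 q r) - (l2 (l2 p q) r + l2 q (l2 p r)) ∈ exactPart ϖ ⊔ kerPart ϖ := by
  refine mem_sup_iff.2 ⟨?_, ?_⟩
  · have : (l2 p (l2 q r) - (l2 (l2 p q) r + l2 q (l2 p r))).1.1 = 0 := by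
      change ⁅p.1.1, ⁅q.1.1, r.1.1⁆⁆ - (⁅⁅p.1.1, q.1.1⁆, r.1.1⁆ + ⁅q.1.1, ⁅p.1.1, r.1.1⁆⁆) = 0
      rw [leibniz_lie, sub_self]
    rw [this]
    exact Submodule.zero_mem _
  · have h := jacobi_exact (d_contract_of_L0 p) (d_contract_of_L0 q) (d_contract_of_L0 r)
    have e1 : contract m ⁅q.1.1, r.1.1⁆ (contract (m + 1) p.1.1 ϖ.1) =
      - contract m p.1.1 (contract (m + 1) ⁅q.1.1, r.1.1⁆ ϖ.1) := contract_anticomm _ _ _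
    have e2 : contract m ⁅p.1.1, r.1.1⁆ (contract (m + 1) q.1.1 ϖ.1) =
      - contract m q.1.1 (contract (m + 1) ⁅p.1.1, r.1.1⁆ ϖ.1) := contract_anticomm _ _ _
    have e3 : ⁅r.1.1, p.1.1⁆ = -⁅p.1.1, r.1.1⁆ := (lie_skew _ _).symm
    have e : (l2 p (l2 q r) - (l2 (l2 p q) r + l2 q (l2 p r))).1.2 =
        -(contract m p.1.1 (contract (m + 1) ⁅q.1.1, r.1.1⁆ ϖ.1)
          + contract m q.1.1 (contract (m + 1) ⁅r.1.1, p.1.1⁆ ϖ.1)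
          + contract m r.1.1 (contract (m + 1) ⁅p.1.1, q.1.1⁆ ϖ.1)) := by
      change contract m ⁅q.1.1, r.1.1⁆ (contract (m + 1) p.1.1 ϖ.1) -
        (contract m r.1.1 (contract (m + 1) ⁅p.1.1, q.1.1⁆ ϖ.1)
          + contract m ⁅p.1.1, r.1.1⁆ (contract (m + 1) q.1.1 ϖ.1)) = _
      rw [e1, e2, e3]
      simp only [map_neg, LinearMap.neg_apply]
      abel
    rw [e]
    exact Submodule.neg_mem _ h

lemma l2bar_self (x : ObsQuot ϖ) : l2bar ϖ x x = 0 := by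
  obtain ⟨p, rfl⟩ := ObsQuot.mk_surjective x
  rw [l2bar_mk, l2_self, map_zero]

lemma l2bar_leibniz (x y z : ObsQuot ϖ) :
    l2bar ϖ x (l2bar ϖ y z) = l2bar ϖ (l2bar ϖ x y) z + l2bar ϖ y (l2bar ϖ x z) := by
  obtain ⟨p, rfl⟩ := ObsQuot.mk_surjective x
  obtain ⟨q, rfl⟩ := ObsQuot.mk_surjective y
  obtain ⟨r, rfl⟩ := ObsQuot.mk_surjective z
  simp only [l2bar_mk]
  rw [← map_add, ← sub_eq_zero, ← map_sub]
  exact ObsQuot.mk_eq_zero.2 (l2_leibniz p q r)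

noncomputable instance : Bracket (ObsQuot ϖ) (ObsQuot ϖ) where
  bracket x y := l2bar ϖ x y

/-- The Lie algebra structure on the quotient, with the bracket `l2bar` induced by `l₂`. -/
noncomputable instance : LieRing (ObsQuot ϖ) where
  add_lie x y z := LinearMap.map_add₂ (l2bar ϖ) x y z
  lie_add x y z := (l2bar ϖ x).map_add y z
  lie_self x := l2bar_self x
  leibniz_lie x y z := l2bar_leibniz x y z

noncomputable instance : LieAlgebra ℝ (ObsQuot ϖ) where
  lie_smul c x y := (l2bar ϖ x).map_smul c y

variable (ϖ) in
/-- The Lie algebra `𝔛_Ham(M, ϖ)` of Hamiltonian vector fields: the image of `L0` in `𝔛(M)`. -/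
noncomputable def HamFields : LieSubalgebra ℝ (VF E M) where
  toSubmodule := (L0 ϖ).map (LinearMap.fst ℝ _ _)
  lie_mem' := by
    rintro _ _ ⟨p, hp, rfl⟩ ⟨q, hq, rfl⟩
    exact ⟨_, (l2 ⟨p, hp⟩ ⟨q, hq⟩).2, rfl⟩

lemma d_contract_of_Ham {v : VF E M} (hv : v ∈ HamFields ϖ) :
    d (m + 1) (contract (m + 1) v ϖ.1) = 0 := by
  obtain ⟨p, hp, rfl⟩ := hv
  exact d_contract_of_L0 ⟨p, hp⟩

variable (ϖ) in
/-- The ideal `ker(ι_• ϖ)` of `𝔛_Ham(M, ϖ)`. -/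
noncomputable def kerIdeal : LieIdeal ℝ (HamFields ϖ) where
  toSubmodule := (kerContract ϖ).submoduleOf (HamFields ϖ).toSubmodule
  lie_mem := by
    intro v w hw
    have hw' : contract (m + 1) w.1 ϖ.1 = 0 := hw
    have := contract_bracket_of_closed (d_contract_of_Ham v.2) (d_contract_of_Ham w.2)
    rw [contract_anticomm, hw', map_zero, neg_zero, map_zero] at this
    exact neg_eq_zero.1 this.symm

/-- The projection `L0 → 𝔛_Ham(M, ϖ)`. -/
noncomputable def projHam : L0 ϖ →ₗ[ℝ] HamFields ϖ :=
  LinearMap.codRestrict (HamFields ϖ).toSubmodule ((LinearMap.fst ℝ _ _).comp (L0 ϖ).subtype)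
    (fun p => ⟨p.1, p.2, rfl⟩)

variable (ϖ) in
/-- The induced projection `L0 / (Ω^m_{ex}(M) ⊕ ker(ι_• ϖ)) → 𝔛_Ham(M, ϖ) / ker(ι_• ϖ)`. -/
noncomputable def projBar : ObsQuot ϖ →ₗ[ℝ] (HamFields ϖ ⧸ kerIdeal ϖ) :=
  ObsQuot.lift ϖ (((LieSubmodule.Quotient.mk' (kerIdeal ϖ) :) :
      HamFields ϖ →ₗ[ℝ] (HamFields ϖ ⧸ kerIdeal ϖ)).comp projHam)
    (fun _ hp => (LieSubmodule.Quotient.mk_eq_zero (N := kerIdeal ϖ)).2 (mem_sup_iff.1 hp).1)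

variable (ϖ) in
/-- The map `α ↦ (0, α)` from closed forms to `L0`. -/
noncomputable def closedIncl : closedForms E M m →ₗ[ℝ] L0 ϖ :=
  LinearMap.codRestrict (L0 ϖ) ((LinearMap.inr ℝ (VF E M) (DiffForm E M m)).comp
    (closedForms E M m).subtype) (fun α => by
      change d m α.1 = - contract (m + 1) 0 ϖ.1
      rw [show d m α.1 = 0 from α.2]; simp)

variable (ϖ) in
/-- The inclusion `H^m_{dR}(M) → L0 / (Ω^m_{ex}(M) ⊕ ker(ι_• ϖ))`, `[α] ↦ [(0, α)]`. -/
noncomputable def deRhamIncl : deRham E M m →ₗ[ℝ] ObsQuot ϖ :=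
  Submodule.liftQ _ ((ObsQuot.mk ϖ).comp (closedIncl ϖ))
    (fun _ hα => ObsQuot.mk_eq_zero.2 (mem_sup_iff.2 ⟨Submodule.zero_mem _, hα⟩))

end Observables

section Cochains
open LieModule.Cohomology TensorProduct

variable (𝔤 : Type*) [LieRing 𝔤] [LieAlgebra ℝ 𝔤]

instance (V : Type*) [AddCommGroup V] [Module ℝ V] : AddCommGroup (twoCochain ℝ 𝔤 V) :=
  Submodule.addCommGroup _

/-- The space `Λ²𝔤*` of scalar valued Chevalley-Eilenberg 2-cochains of `𝔤`. -/
abbrev Lam2 : Type _ := twoCochain ℝ 𝔤 (TrivialLieModule ℝ 𝔤 ℝ)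

/-- The closed elements of `Λ²𝔤*`. -/
abbrev Z2 : Submodule ℝ (Lam2 𝔤) := twoCocycle ℝ 𝔤 (TrivialLieModule ℝ 𝔤 ℝ)

/-- The exact elements of `Λ²𝔤*`. -/
noncomputable abbrev B2 : Submodule ℝ (Lam2 𝔤) :=
  LinearMap.range (d₁₂ ℝ 𝔤 (TrivialLieModule ℝ 𝔤 ℝ))

/-- The cohomology space `H²(𝔤)` of `𝔤` with trivial coefficients. -/
abbrev H2 : Type _ := Z2 𝔤 ⧸ (B2 𝔤).submoduleOf (Z2 𝔤)

variable {𝔤} {V : Type*} [AddCommGroup V] [Module ℝ V]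

/-- Evaluation of a scalar valued 2-cochain. -/
noncomputable def evalAt (X Y : 𝔤) : Lam2 𝔤 →ₗ[ℝ] ℝ where
  toFun φ := TrivialLieModule.equiv ℝ 𝔤 ℝ (φ X Y)
  map_add' φ ψ := by simp
  map_smul' r φ := by simp

lemma evalAt_apply (X Y : 𝔤) (φ : Lam2 𝔤) :
    evalAt X Y φ = TrivialLieModule.equiv ℝ 𝔤 ℝ (φ X Y) := rfl

variable (𝔤 V) in
/-- The canonical map `Λ²𝔤* ⊗ V → Λ²(𝔤, V)`, `φ ⊗ v ↦ ((X, Y) ↦ φ(X, Y) v)`. -/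
noncomputable def evalTensor : Lam2 𝔤 ⊗[ℝ] V →ₗ[ℝ] twoCochain ℝ 𝔤 V :=
  TensorProduct.lift (LinearMap.mk₂ ℝ
    (fun φ v => ⟨LinearMap.mk₂ ℝ (fun X Y => evalAt X Y φ • v)
      (fun X X' Y => by simp [evalAt_apply, add_smul])
      (fun r X Y => by simp [evalAt_apply, mul_smul])
      (fun X Y Y' => by simp [evalAt_apply, add_smul])
      (fun r X Y => by simp [evalAt_apply, mul_smul]),
      fun X => by simp [evalAt_apply]⟩)
    (fun φ ψ v => by ext X Y; exact (congrArg (· • v) (map_add _ _ _)).trans (add_smul _ _ _))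
    (fun r φ v => by ext X Y; exact (congrArg (· • v) (map_smul _ _ _)).trans (smul_assoc _ _ _))
    (fun φ v w => by ext X Y; exact smul_add _ _ _)
    (fun r φ v => by ext X Y; exact smul_comm _ _ _))

lemma evalTensor_tmul (φ : Lam2 𝔤) (v : V) (X Y : 𝔤) :
    evalTensor 𝔤 V (φ ⊗ₜ v) X Y = evalAt X Y φ • v := rfl

lemma evalTensor_apply (t : Lam2 𝔤 ⊗[ℝ] V) (X Y : 𝔤) :
    evalTensor 𝔤 V t X Y = TensorProduct.lid ℝ V ((evalAt X Y).rTensor V t) := by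
  induction t with
  | zero => simp; rfl
  | tmul φ v => simp [evalTensor_tmul]
  | add a b ha hb => rw [map_add, add_apply_apply, ha, hb, map_add, map_add]

/-- If linear forms on `W` separate points then they do so on `W ⊗ V`. -/
lemma tensor_eq_zero {W : Type*} [AddCommMonoid W] [Module ℝ W] {ι : Type*} (e : ι → W →ₗ[ℝ] ℝ) (he : ∀ w, (∀ i, e i w = 0) → w = 0)
    (t : W ⊗[ℝ] V) (ht : ∀ i, (e i).rTensor V t = 0) : t = 0 := by
  let b := Module.Free.chooseBasis ℝ V
  have key : ∀ (i : ι) (t : W ⊗[ℝ] V) (k), e i (TensorProduct.equivFinsuppOfBasisRight b t k) =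
      TensorProduct.equivFinsuppOfBasisRight b ((e i).rTensor V t) k := by
    intro i t k
    induction t with
    | zero => simp
    | tmul w v => simp
    | add a b ha hb => simp only [map_add, Finsupp.add_apply, ha, hb]
  apply (TensorProduct.equivFinsuppOfBasisRight b).injective
  ext k
  rw [map_zero, Finsupp.zero_apply]
  refine he _ fun i => ?_
  rw [key, ht, map_zero, Finsupp.zero_apply]

lemma evalTensor_injective : Function.Injective (evalTensor 𝔤 V) := by
  rw [injective_iff_map_eq_zero]
  intro t ht
  refine tensor_eq_zero (fun p : 𝔤 × 𝔤 => evalAt p.1 p.2) (fun φ h => ?_) t (fun p => ?_)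
  · ext X Y
    exact (TrivialLieModule.equiv ℝ 𝔤 ℝ).injective ((h (X, Y)).trans (map_zero _).symm)
  · apply (TensorProduct.lid ℝ V).injective
    rw [← evalTensor_apply, ht, map_zero]; rfl

/-- The wedge product of two linear forms. -/
noncomputable def wedge (f g : Module.Dual ℝ 𝔤) : Lam2 𝔤 :=
  ⟨LinearMap.mk₂ ℝ (fun X Y => (TrivialLieModule.equiv ℝ 𝔤 ℝ).symm (f X * g Y - f Y * g X))
      (fun X X' Y => by rw [← map_add]; congr 1; simp; ring)
      (fun r X Y => by rw [← map_smul]; congr 1; simp; ring)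
      (fun X Y Y' => by rw [← map_add]; congr 1; simp; ring)
      (fun r X Y => by rw [← map_smul]; congr 1; simp; ring),
    fun X => by simp⟩

lemma evalAt_wedge (f g : Module.Dual ℝ 𝔤) (X Y : 𝔤) :
    evalAt X Y (wedge f g) = f X * g Y - f Y * g X := rfl

variable [FiniteDimensional ℝ 𝔤]

lemma evalTensor_surjective : Function.Surjective (evalTensor 𝔤 V) := by
  intro c
  let b := Module.Free.chooseBasis ℝ 𝔤
  have hc : ∀ X Y, c X Y = ∑ i, ∑ j, (b.coord i X * b.coord j Y) • c (b i) (b j) := by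
    intro X Y
    conv_lhs => rw [← b.sum_repr X, ← b.sum_repr Y]
    simp only [map_sum, map_smul, LinearMap.sum_apply, LinearMap.smul_apply, Finset.smul_sum,
      smul_smul]
    rw [Finset.sum_comm]
    refine Finset.sum_congr rfl fun i _ => Finset.sum_congr rfl fun j _ => ?_
    simp [mul_comm]
  refine ⟨(2⁻¹ : ℝ) • ∑ i, ∑ j, wedge (b.coord i) (b.coord j) ⊗ₜ c (b i) (b j), ?_⟩
  ext X Y
  change evalTensor 𝔤 V _ X Y = c X Y
  rw [evalTensor_apply]
  simp only [map_smul, map_sum, LinearMap.rTensor_tmul, TensorProduct.lid_tmul, evalAt_wedge,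
    sub_smul, Finset.sum_sub_distrib]
  rw [← hc, ← hc, ← twoCochain_skew c X Y, sub_neg_eq_add, ← two_smul ℝ, smul_smul]
  norm_num

variable (𝔤 V) in
/-- For finite dimensional `𝔤`, the canonical isomorphism `Λ²𝔤* ⊗ V ≅ Λ²(𝔤, V)`. -/
noncomputable def cochainTensorEquiv : Lam2 𝔤 ⊗[ℝ] V ≃ₗ[ℝ] twoCochain ℝ 𝔤 V :=
  LinearEquiv.ofBijective (evalTensor 𝔤 V) ⟨evalTensor_injective, evalTensor_surjective⟩

end Cochains

section CochainLemmas
open LieModule.Cohomology TensorProduct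

variable {𝔤 : Type*} [LieRing 𝔤] [LieAlgebra ℝ 𝔤]
  {V W : Type*} [AddCommGroup V] [Module ℝ V] [AddCommGroup W] [Module ℝ W]

/-- The inclusion `B / A → V / A` for subspaces `A ⊆ B ⊆ V`. -/
noncomputable def quotIncl (A B : Submodule ℝ V) : (B ⧸ A.submoduleOf B) →ₗ[ℝ] V ⧸ A :=
  Submodule.mapQ _ _ B.subtype le_rfl

lemma flat_quot (A : Submodule ℝ V) : Module.Flat ℝ (V ⧸ A) := inferInstance

lemma quotIncl_injective (A B : Submodule ℝ V) : Function.Injective (quotIncl A B) := by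
  rw [injective_iff_map_eq_zero]
  intro x hx
  obtain ⟨b, rfl⟩ := Submodule.mkQ_surjective _ x
  exact (Submodule.Quotient.mk_eq_zero _).2 ((Submodule.Quotient.mk_eq_zero A (x := b.1)).1 hx)

/-- Composition of a 2-cochain with a linear map. -/
noncomputable def mapCochain (f : V →ₗ[ℝ] W) (c : twoCochain ℝ 𝔤 V) : twoCochain ℝ 𝔤 W :=
  ⟨c.1.compr₂ f, fun X => (congrArg f (c.2 X)).trans (map_zero f)⟩

lemma mapCochain_apply (f : V →ₗ[ℝ] W) (c : twoCochain ℝ 𝔤 V) (X Y : 𝔤) :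
    mapCochain f c X Y = f (c X Y) := rfl

lemma evalTensor_lTensor (f : V →ₗ[ℝ] W) (t : Lam2 𝔤 ⊗[ℝ] V) :
    evalTensor 𝔤 W (f.lTensor _ t) = mapCochain f (evalTensor 𝔤 V t) := by
  ext X Y
  change evalTensor 𝔤 W _ X Y = f (evalTensor 𝔤 V t X Y)
  rw [evalTensor_apply, evalTensor_apply]
  induction t with
  | zero => simp
  | tmul φ v => simp
  | add a b ha hb => simp only [map_add, ha, hb]

/-- The 2-cochain `(X, Y) ↦ -β([X, Y])`. -/
noncomputable def cobound (β : 𝔤 →ₗ[ℝ] V) : twoCochain ℝ 𝔤 V :=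
  ⟨LinearMap.mk₂ ℝ (fun X Y => - β ⁅X, Y⁆) (fun _ _ _ => by simp; abel) (fun _ _ _ => by simp)
    (fun _ _ _ => by simp; abel) (fun _ _ _ => by simp), fun X => by simp⟩

lemma cobound_apply (β : 𝔤 →ₗ[ℝ] V) (X Y : 𝔤) : cobound β X Y = - β ⁅X, Y⁆ := rfl

lemma rTensor_mkQ_eq_zero [FiniteDimensional ℝ 𝔤] (β : 𝔤 →ₗ[ℝ] V) (t : Lam2 𝔤 ⊗[ℝ] V)
    (ht : evalTensor 𝔤 V t = cobound β) : (B2 𝔤).mkQ.rTensor V t = 0 := by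
  let b := Module.Free.chooseBasis ℝ 𝔤
  have : t = ∑ i, d₁₂ ℝ 𝔤 (TrivialLieModule ℝ 𝔤 ℝ)
      ((TrivialLieModule.equiv ℝ 𝔤 ℝ).symm.toLinearMap ∘ₗ b.coord i) ⊗ₜ β (b i) := by
    apply evalTensor_injective
    rw [ht, map_sum]
    ext X Y
    change - β ⁅X, Y⁆ = (∑ i, evalTensor 𝔤 V _ : twoCochain ℝ 𝔤 V).1 X Y
    rw [AddSubmonoidClass.coe_finsetSum, LinearMap.sum_apply, LinearMap.sum_apply]
    conv_lhs => rw [← b.sum_repr ⁅X, Y⁆, map_sum, ← Finset.sum_neg_distrib]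
    refine Finset.sum_congr rfl fun i _ => ?_
    change _ = evalAt X Y _ • β (b i)
    rw [evalAt_apply, d₁₂_apply_apply_ofTrivial]
    simp
  rw [this, map_sum]
  refine Finset.sum_eq_zero fun i _ => ?_
  have h0 : ∀ f, (B2 𝔤).mkQ (d₁₂ ℝ 𝔤 (TrivialLieModule ℝ 𝔤 ℝ) f) = 0 := fun f =>
    (Submodule.Quotient.mk_eq_zero (B2 𝔤)).2 ⟨f, rfl⟩
  rw [LinearMap.rTensor_tmul, h0, TensorProduct.zero_tmul]

lemma mem_range_rTensor {A : Type*} [AddCommGroup A] [Module ℝ A] (S : Submodule ℝ A)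
    {ι : Type*} (e : ι → A →ₗ[ℝ] ℝ) (hS : ∀ a, (∀ i, e i a = 0) ↔ a ∈ S) (t : A ⊗[ℝ] V)
    (ht : ∀ i, (e i).rTensor V t = 0) : ∃ z, S.subtype.rTensor V z = t := by
  have hex : Function.Exact S.subtype (LinearMap.pi e) := by
    intro a
    rw [Submodule.coe_subtype, Subtype.range_coe, SetLike.mem_coe, ← hS, funext_iff]
    rfl
  refine (Module.Flat.rTensor_exact V hex t).1 ?_
  refine tensor_eq_zero (fun i => LinearMap.proj i) (fun w hw => funext hw) _ fun i => ?_
  rw [← LinearMap.comp_apply, ← LinearMap.rTensor_comp, LinearMap.proj_pi, ht]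

lemma mem_Z2 (φ : Lam2 𝔤) : (∀ p : 𝔤 × 𝔤 × 𝔤,
    (evalAt ⁅p.1, p.2.1⁆ p.2.2 - evalAt ⁅p.1, p.2.2⁆ p.2.1 + evalAt ⁅p.2.1, p.2.2⁆ p.1) φ = 0) ↔
      φ ∈ Z2 𝔤 := by
  have key : ∀ X Y Z : 𝔤, (evalAt ⁅X, Y⁆ Z - evalAt ⁅X, Z⁆ Y + evalAt ⁅Y, Z⁆ X) φ =
      - TrivialLieModule.equiv ℝ 𝔤 ℝ (d₂₃ ℝ 𝔤 (TrivialLieModule ℝ 𝔤 ℝ) φ X Y Z) := by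
    intro X Y Z
    simp [evalAt_apply, trivial_lie_zero]
    ring
  rw [mem_twoCocycle_iff]
  constructor
  · intro h
    ext X Y Z
    exact (TrivialLieModule.equiv ℝ 𝔤 ℝ).injective
      ((neg_eq_zero.1 ((key X Y Z).symm.trans (h (X, Y, Z)))).trans (map_zero _).symm)
  · rintro h ⟨X, Y, Z⟩
    rw [key, h]
    exact neg_eq_zero.2 (map_zero _)

lemma exists_cocycle [FiniteDimensional ℝ 𝔤] (c : twoCochain ℝ 𝔤 V)
    (hc : ∀ X Y Z, c ⁅X, Y⁆ Z - c ⁅X, Z⁆ Y + c ⁅Y, Z⁆ X = 0) :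
    ∃ z : Z2 𝔤 ⊗[ℝ] V, evalTensor 𝔤 V ((Z2 𝔤).subtype.rTensor V z) = c := by
  obtain ⟨t, ht⟩ := evalTensor_surjective c
  obtain ⟨z, hz⟩ := mem_range_rTensor (Z2 𝔤) _ mem_Z2 t (fun p => by
    have h := hc p.1 p.2.1 p.2.2
    rw [← ht] at h
    simp only [evalTensor_apply, ← map_add, ← map_sub] at h
    rw [LinearMap.rTensor_add, LinearMap.rTensor_sub]
    exact (LinearEquiv.map_eq_zero_iff _).1 h)
  exact ⟨z, (congrArg _ hz).trans ht⟩

end CochainLemmas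

section Obstruction
set_option linter.unusedSectionVars false
open LieModule.Cohomology TensorProduct

variable {E : Type*} [NormedAddCommGroup E] [NormedSpace ℝ E] [FiniteDimensional ℝ E]
  {M : Type*} [TopologicalSpace M] [ChartedSpace E M] [IsManifold 𝓘(ℝ, E) ∞ M]
  {𝔤 : Type*} [LieRing 𝔤] [LieAlgebra ℝ 𝔤]
  {m : ℕ} (ϖ : closedForms E M (m + 2)) (ζ : 𝔤 →ₗ⁅ℝ⁆ VF E M)

/-- The action `ζ` is weakly Hamiltonian: it has a linear lift `𝔤 → L0`. -/
def WeaklyHamiltonian : Prop := ∃ j : 𝔤 →ₗ[ℝ] L0 ϖ, ∀ X, (j X).1.1 = ζ X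

variable {ϖ ζ}

lemma WeaklyHamiltonian.mem (hζ : WeaklyHamiltonian ϖ ζ) (X : 𝔤) : ζ X ∈ HamFields ϖ := by
  obtain ⟨j, hj⟩ := hζ
  exact ⟨(j X).1, (j X).2, hj X⟩

lemma WeaklyHamiltonian.lieDeriv_eq_zero (hζ : WeaklyHamiltonian ϖ ζ) (X : 𝔤) :
    lieDeriv (ζ X) ϖ.1 = 0 := by
  rw [lieDeriv, d_contract_of_Ham (hζ.mem X), d_closed, map_zero, add_zero]

/-- The map `ζ̄ : 𝔤 → 𝔛_Ham(M, ϖ) / ker(ι_• ϖ)` induced by a weakly Hamiltonian action. -/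
noncomputable def zetaBar (hζ : WeaklyHamiltonian ϖ ζ) : 𝔤 →ₗ[ℝ] HamFields ϖ ⧸ kerIdeal ϖ :=
  ((LieSubmodule.Quotient.mk' (kerIdeal ϖ) :) : HamFields ϖ →ₗ[ℝ] (HamFields ϖ ⧸ kerIdeal ϖ)).comp
    (LinearMap.codRestrict (HamFields ϖ).toSubmodule (ζ : 𝔤 →ₗ[ℝ] VF E M) hζ.mem)

variable (ϖ ζ)

/-- The cochain `g₂ ∈ Λ²(𝔤, Ω^m(M))`, `g₂(X, Y) = ι_{ζ(Y)} ι_{ζ(X)} ϖ`. -/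
noncomputable def g2 : twoCochain ℝ 𝔤 (DiffForm E M m) :=
  ⟨LinearMap.mk₂ ℝ (fun X Y => contract m (ζ Y) (contract (m + 1) (ζ X) ϖ.1))
    (fun _ _ _ => by simp) (fun _ _ _ => by simp) (fun _ _ _ => by simp) (fun _ _ _ => by simp),
    fun X => by
      apply DiffForm.ext; funext x
      exact ContinuousAlternatingMap.curryLeft_same (E := E) (ϖ.1.1 x) (ζ X x)⟩

lemma g2_apply (X Y : 𝔤) : g2 ϖ ζ X Y = contract m (ζ Y) (contract (m + 1) (ζ X) ϖ.1) := rfl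

variable (E M 𝔤 m) in
/-- The inclusion of `H²(𝔤) ⊗ H^m_{dR}(M)` into the tensor product of the spaces of all cochains
modulo exact ones and all forms modulo exact ones. -/
noncomputable def cohIncl : H2 𝔤 ⊗[ℝ] deRham E M m →ₗ[ℝ]
    (Lam2 𝔤 ⧸ B2 𝔤) ⊗[ℝ] (DiffForm E M m ⧸ exactForms E M m) :=
  TensorProduct.map (quotIncl (B2 𝔤) (Z2 𝔤)) (quotIncl (exactForms E M m) (closedForms E M m))

lemma cohIncl_injective : Function.Injective (cohIncl E M 𝔤 m) :=
  have : Module.Flat ℝ (Lam2 𝔤 ⧸ B2 𝔤) := flat_quot _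
  have : Module.Flat ℝ (deRham E M m) := flat_quot _
  TensorProduct.map_injective_of_flat_flat _ _ (quotIncl_injective _ _) (quotIncl_injective _ _)

variable [FiniteDimensional ℝ 𝔤]

/-- The image `(q_Λ ⊗ q_Ω)(g₂)` of `g₂`, where `q_Λ` and `q_Ω` are the projections of `Λ²𝔤*` and
`Ω^m(M)` to their quotients by the exact elements. -/
noncomputable def g2Class : (Lam2 𝔤 ⧸ B2 𝔤) ⊗[ℝ] (DiffForm E M m ⧸ exactForms E M m) :=
  TensorProduct.map (B2 𝔤).mkQ (exactForms E M m).mkQ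
    ((cochainTensorEquiv 𝔤 (DiffForm E M m)).symm (g2 ϖ ζ))

variable {ϖ ζ}

lemma closed_cochain (j : 𝔤 →ₗ[ℝ] L0 ϖ) (hj : ∀ X, (j X).1.1 = ζ X) (X Y : 𝔤) :
    g2 ϖ ζ X Y - (j ⁅X, Y⁆).1.2 ∈ closedForms E M m := by
  have h := contract_bracket_of_closed (d_contract_of_L0 (j X)) (d_contract_of_L0 (j Y))
  rw [hj, hj] at h
  change d m _ = 0
  rw [map_sub, g2_apply, h, L0_d, hj, LieHom.map_lie, sub_self]

/-- The class `g₂` lies in `H²(𝔤) ⊗ H^m_{dR}(M)`. -/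
lemma exists_h2 (hζ : WeaklyHamiltonian ϖ ζ) :
    ∃ h : H2 𝔤 ⊗[ℝ] deRham E M m, cohIncl E M 𝔤 m h = g2Class ϖ ζ := by
  obtain ⟨j, hj⟩ := hζ
  let c₀ : twoCochain ℝ 𝔤 (closedForms E M m) :=
    ⟨LinearMap.mk₂ ℝ (fun X Y => ⟨g2 ϖ ζ X Y - (j ⁅X, Y⁆).1.2, closed_cochain j hj X Y⟩)
      (fun _ _ _ => by ext1; simp; abel) (fun _ _ _ => by ext1; simp [smul_sub])
      (fun _ _ _ => by ext1; simp; abel) (fun _ _ _ => by ext1; simp [smul_sub]),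
      fun X => by ext1; simp⟩
  have hc₀ : ∀ X Y, (c₀ X Y).1 = g2 ϖ ζ X Y - (j ⁅X, Y⁆).1.2 := fun _ _ => rfl
  let c : twoCochain ℝ 𝔤 (deRham E M m) := mapCochain (Submodule.mkQ _) c₀
  have hc : ∀ X Y Z, c ⁅X, Y⁆ Z - c ⁅X, Z⁆ Y + c ⁅Y, Z⁆ X = 0 := by
    intro X Y Z
    simp only [c, mapCochain_apply]
    rw [← map_sub, ← map_add]
    refine (Submodule.Quotient.mk_eq_zero _).2 ?_
    change (c₀ ⁅X, Y⁆ Z).1 - (c₀ ⁅X, Z⁆ Y).1 + (c₀ ⁅Y, Z⁆ X).1 ∈ exactForms E M m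
    have hH : ∀ X, d (m + 1) (contract (m + 1) (ζ X) ϖ.1) = 0 := fun X => by
      rw [← hj]; exact d_contract_of_L0 _
    have h := jacobi_exact (hH X) (hH Y) (hH Z)
    convert h using 1
    have hJ : (j ⁅⁅X, Y⁆, Z⁆).1.2 - (j ⁅⁅X, Z⁆, Y⁆).1.2 + (j ⁅⁅Y, Z⁆, X⁆).1.2 = 0 := by
      have : ⁅⁅X, Y⁆, Z⁆ - ⁅⁅X, Z⁆, Y⁆ + ⁅⁅Y, Z⁆, X⁆ = 0 := by
        rw [← lie_skew ⁅X, Z⁆ Y, ← lie_skew ⁅Y, Z⁆ X, leibniz_lie X Y Z]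
        abel
      have := congrArg (fun p : L0 ϖ => p.1.2) (congrArg j this)
      simpa using this
    simp only [hc₀, g2_apply, LieHom.map_lie]
    have e : ⁅ζ Z, ζ X⁆ = -⁅ζ X, ζ Z⁆ := (lie_skew _ _).symm
    rw [e, map_neg, LinearMap.neg_apply, map_neg]
    rw [← sub_eq_zero, ← neg_eq_zero.2 hJ]
    abel
  obtain ⟨z, hz⟩ := exists_cocycle c hc
  refine ⟨((B2 𝔤).submoduleOf (Z2 𝔤)).mkQ.rTensor _ z, ?_⟩
  set t := (Z2 𝔤).subtype.rTensor (deRham E M m) z with ht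
  set s := (cochainTensorEquiv 𝔤 (DiffForm E M m)).symm (g2 ϖ ζ) with hs
  have hs' : evalTensor 𝔤 (DiffForm E M m) s = g2 ϖ ζ :=
    (cochainTensorEquiv 𝔤 (DiffForm E M m)).apply_symm_apply _
  let q := (exactForms E M m).mkQ
  let i := quotIncl (exactForms E M m) (closedForms E M m)
  have h1 : cohIncl E M 𝔤 m (((B2 𝔤).submoduleOf (Z2 𝔤)).mkQ.rTensor _ z) =
      (B2 𝔤).mkQ.rTensor _ (i.lTensor _ t) := by
    rw [ht]
    clear_value t
    clear hz ht
    induction z with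
    | zero => simp
    | tmul φ v => rfl
    | add a b ha hb => simp only [map_add, ha, hb]
  have h2 : g2Class ϖ ζ = (B2 𝔤).mkQ.rTensor _ (q.lTensor _ s) := by
    rw [← LinearMap.comp_apply, LinearMap.rTensor_comp_lTensor]
    rfl
  have h3 : (B2 𝔤).mkQ.rTensor _ (i.lTensor _ t - q.lTensor _ s) = 0 := by
    refine rTensor_mkQ_eq_zero (q ∘ₗ LinearMap.snd ℝ _ _ ∘ₗ (L0 ϖ).subtype ∘ₗ j) _ ?_
    rw [map_sub, evalTensor_lTensor, evalTensor_lTensor, hz, hs']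
    ext X Y
    change q (g2 ϖ ζ X Y - (j ⁅X, Y⁆).1.2) - q (g2 ϖ ζ X Y) = - q (j ⁅X, Y⁆).1.2
    rw [map_sub]
    abel
  rw [h1, h2, ← sub_eq_zero, ← map_sub, h3]

/-- The second obstruction class `h₂ ∈ H²(𝔤) ⊗ H^m_{dR}(M)` of a weakly Hamiltonian action: the
unique element whose image under the inclusion `cohIncl` is `(q_Λ ⊗ q_Ω)(g₂)`. -/
noncomputable def h2 (hζ : WeaklyHamiltonian ϖ ζ) : H2 𝔤 ⊗[ℝ] deRham E M m :=
  (exists_h2 hζ).choose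

lemma cohIncl_h2 (hζ : WeaklyHamiltonian ϖ ζ) : cohIncl E M 𝔤 m (h2 hζ) = g2Class ϖ ζ :=
  (exists_h2 hζ).choose_spec

/-- The element `z` of `Z²(𝔤) ⊗ H^m_{dR}(M)` is the cocycle
`(X, Y) ↦ l̄₂(j̄(X), j̄(Y)) - j̄([X, Y])`. -/
def IsLiftCocycle (jbar : 𝔤 →ₗ[ℝ] ObsQuot ϖ) (z : Z2 𝔤 ⊗[ℝ] deRham E M m) : Prop :=
  ∀ X Y, deRhamIncl ϖ (evalTensor 𝔤 (deRham E M m) ((Z2 𝔤).subtype.rTensor _ z) X Y) =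
    ⁅jbar X, jbar Y⁆ - jbar ⁅X, Y⁆

variable (E M 𝔤 m) in
/-- The projection `Z²(𝔤) ⊗ H^m_{dR}(M) → H²(𝔤) ⊗ H^m_{dR}(M)`. -/
noncomputable def classCE : Z2 𝔤 ⊗[ℝ] deRham E M m →ₗ[ℝ] H2 𝔤 ⊗[ℝ] deRham E M m :=
  ((B2 𝔤).submoduleOf (Z2 𝔤)).mkQ.rTensor _

end Obstruction

end Multisymplectic

open Multisymplectic TensorProduct

/-! The quotient `ObsQuot ϖ` is a central extension by $H^m_{dR}(M)$: its bracket uses only vector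
field components, and a class $[(0,\alpha)]$ has none (`deRhamIncl_lie`). Hence the defect $\bar c$
of a linear lift $\bar j$ of $\bar\zeta$ is a 2-cocycle with trivial coefficients, and some lift is
a homomorphism exactly when the class of $\bar c$ vanishes. What needs proof is that this class is
$h_2$, which is defined from $g_2$ without any lift.

By `exists_lift_of_projBar_eq`, $\bar j$ is induced by a linear map $j=(\zeta,a)$ into `L0 ϖ`. Since
$\zeta$ is a homomorphism, the defect has no vector field component, and $\bar c(X,Y)$ is the class
of the closed form $g_2(X,Y)-a([X,Y])$. Modulo exact forms, $-a([X,Y])$ is a Chevalley-Eilenberg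
coboundary. Its values need not be closed, so it can be discarded only in $(\Lambda^2\mathfrak
g^*/(\Lambda^2\mathfrak g^*)_{ex})\otimes(\Omega^m/\Omega^m_{ex})$. There $\bar c$ and $g_2$ have
the same image (`cohIncl_classCE_of_liftCochain`), and injectivity of `cohIncl` gives $[\bar
c]=h_2$.

A homomorphic lift has $\bar c=0$, hence $h_2=0$. Conversely, if $h_2=0$ then $\bar
c(X,Y)=-\beta([X,Y])$ for a linear map $\beta:\mathfrak g\to H^m_{dR}(M)$
(`exists_cobound_of_rTensor_mkQ_eq_zero`), and by centrality $\bar j-\beta$ is a homomorphism. -/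

namespace Multisymplectic

/-! ### Tensors of cocycles as vector-valued cocycles, and their primitives -/

section CochainExactness
open LieModule.Cohomology TensorProduct

variable {𝔤 : Type*} [LieRing 𝔤] [LieAlgebra ℝ 𝔤] {V : Type*} [AddCommGroup V] [Module ℝ V]

/-- Tensoring with a real vector space preserves injections by flatness. This is the source of
uniqueness in part 2: an element of $Z^2(\mathfrak g)\otimes V$ is determined by its values on
pairs. -/
lemma evalTensor_subtype_injective :
    Function.Injective fun z : Z2 𝔤 ⊗[ℝ] V => evalTensor 𝔤 V ((Z2 𝔤).subtype.rTensor V z) :=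
  evalTensor_injective.comp
    (Module.Flat.rTensor_preserves_injective_linearMap _ (Z2 𝔤).subtype_injective)

/-- With trivial coefficients only the bracket term of the differential survives, so $X\mapsto
f(X)v$ is a primitive of $df\otimes v$. -/
lemma evalTensor_coboundary_tmul (f : 𝔤 →ₗ[ℝ] TrivialLieModule ℝ 𝔤 ℝ) (v : V) :
    evalTensor 𝔤 V (d₁₂ ℝ 𝔤 (TrivialLieModule ℝ 𝔤 ℝ) f ⊗ₜ v) =
      cobound (((TrivialLieModule.equiv ℝ 𝔤 ℝ).toLinearMap ∘ₗ f).smulRight v) := by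
  ext X Y
  change evalAt X Y _ • v = - (TrivialLieModule.equiv ℝ 𝔤 ℝ (f ⁅X, Y⁆) • v)
  rw [evalAt_apply, d₁₂_apply_apply_ofTrivial]
  simp

lemma cobound_add (β γ : 𝔤 →ₗ[ℝ] V) : cobound (β + γ) = cobound β + cobound γ := by
  ext X Y
  change -(β ⁅X, Y⁆ + γ ⁅X, Y⁆) = -β ⁅X, Y⁆ + -γ ⁅X, Y⁆
  abel

lemma cobound_zero : cobound (0 : 𝔤 →ₗ[ℝ] V) = 0 := by
  ext X Y
  exact neg_zero

/-- Right exactness of the tensor product, applied to $S\to A\to A/S$. -/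
lemma exists_rTensor_subtype_eq {A : Type*} [AddCommGroup A] [Module ℝ A] (S : Submodule ℝ A)
    (z : A ⊗[ℝ] V) (hz : S.mkQ.rTensor V z = 0) : ∃ w, S.subtype.rTensor V w = z :=
  (rTensor_exact V (LinearMap.exact_subtype_mkQ S) S.mkQ_surjective z).1 hz

/-- Turns the vanishing of a class in $H^2(\mathfrak g)\otimes V$ into an actual $V$-valued
primitive: such a tensor is a finite sum of terms $df\otimes v$, each with an explicit primitive,
and primitives add. -/
lemma exists_cobound_of_rTensor_mkQ_eq_zero (z : Z2 𝔤 ⊗[ℝ] V)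
    (hz : ((B2 𝔤).submoduleOf (Z2 𝔤)).mkQ.rTensor V z = 0) :
    ∃ β : 𝔤 →ₗ[ℝ] V, evalTensor 𝔤 V ((Z2 𝔤).subtype.rTensor V z) = cobound β := by
  obtain ⟨w, rfl⟩ := exists_rTensor_subtype_eq _ z hz
  -- The induction runs over a tensor of coboundaries, for which the conclusion needs no further
  -- hypothesis.
  clear hz
  induction w with
  | zero => exact ⟨0, by rw [map_zero, map_zero, map_zero, cobound_zero]⟩
  | tmul φ v =>
    obtain ⟨f, hf⟩ : (φ : Z2 𝔤).1 ∈ B2 𝔤 := φ.2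
    refine ⟨_, Eq.trans ?_ (evalTensor_coboundary_tmul f v)⟩
    rw [hf]
    rfl
  | add a b ha hb =>
    obtain ⟨β, hβ⟩ := ha
    obtain ⟨γ, hγ⟩ := hb
    exact ⟨β + γ, by rw [map_add, map_add, map_add, hβ, hγ, cobound_add]⟩

end CochainExactness

/-! ### De Rham classes as central elements of `ObsQuot ϖ` -/

section Lifts
open LieModule.Cohomology TensorProduct

variable {E : Type*} [NormedAddCommGroup E] [NormedSpace ℝ E] [FiniteDimensional ℝ E]
  {M : Type*} [TopologicalSpace M] [ChartedSpace E M] [IsManifold 𝓘(ℝ, E) ∞ M]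
  {𝔤 : Type*} [LieRing 𝔤] [LieAlgebra ℝ 𝔤]
  {m : ℕ} {ϖ : closedForms E M (m + 2)} {ζ : 𝔤 →ₗ⁅ℝ⁆ VF E M}

lemma deRhamIncl_mk (α : closedForms E M m) :
    deRhamIncl ϖ (Submodule.mkQ _ α) = ObsQuot.mk ϖ (closedIncl ϖ α) := rfl

/-- The divided-out subspace is described componentwise by `mem_sup_iff`, so $(0,\alpha)$ lies in it
only for exact $\alpha$. Identities between de Rham classes can therefore be checked in `ObsQuot ϖ`.
-/
lemma deRhamIncl_injective : Function.Injective (deRhamIncl ϖ) := by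
  rw [injective_iff_map_eq_zero]
  intro x hx
  obtain ⟨α, rfl⟩ := Submodule.mkQ_surjective _ x
  exact (Submodule.Quotient.mk_eq_zero _).2 (mem_sup_iff.1 (ObsQuot.mk_eq_zero.1 hx)).2

lemma ObsQuot.lie_mk (p q : L0 ϖ) : ⁅ObsQuot.mk ϖ p, ObsQuot.mk ϖ q⁆ = ObsQuot.mk ϖ (l2 p q) := rfl

/-- Both components of `l2` depend only on the vector fields of its arguments, and that of
$(0,\alpha)$ is zero. This centrality gives both the cocycle identity and the correction of a lift
to a homomorphism. -/
lemma deRhamIncl_lie (a : deRham E M m) (x : ObsQuot ϖ) : ⁅deRhamIncl ϖ a, x⁆ = 0 := by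
  obtain ⟨α, rfl⟩ := Submodule.mkQ_surjective _ a
  obtain ⟨p, rfl⟩ := ObsQuot.mk_surjective x
  have h : l2 (closedIncl ϖ α) p = 0 := by
    apply Subtype.ext
    refine Prod.ext (zero_lie p.1.1) ?_
    change contract m p.1.1 (contract (m + 1) 0 ϖ.1) = 0
    simp
  rw [deRhamIncl_mk, ObsQuot.lie_mk, h, map_zero]

lemma lie_deRhamIncl (x : ObsQuot ϖ) (a : deRham E M m) : ⁅x, deRhamIncl ϖ a⁆ = 0 := by
  rw [← lie_skew, deRhamIncl_lie, neg_zero]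

/-- Ensures that changing a lift of $\bar\zeta$ by de Rham classes leaves it a lift. -/
lemma projBar_deRhamIncl (a : deRham E M m) : projBar ϖ (deRhamIncl ϖ a) = 0 := by
  obtain ⟨α, rfl⟩ := Submodule.mkQ_surjective _ a
  exact (LieSubmodule.Quotient.mk_eq_zero (N := kerIdeal ϖ)).2 (Submodule.zero_mem _)

/-! ### Linear lifts of $\bar\zeta$ and uniqueness of their cocycles -/

lemma projBar_mk_eq_zetaBar_iff (hζ : WeaklyHamiltonian ϖ ζ) (p : L0 ϖ) (X : 𝔤) :
    projBar ϖ (ObsQuot.mk ϖ p) = zetaBar hζ X ↔ p.1.1 - ζ X ∈ kerContract ϖ :=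
  Submodule.Quotient.eq (kerIdeal ϖ).toSubmodule (x := projHam p) (y := ⟨ζ X, hζ.mem X⟩)

/-- A linear lift of `ζ̄` to the quotient of `L0` comes from a linear lift of `ζ` to `L0`. -/
lemma exists_lift_of_projBar_eq (hζ : WeaklyHamiltonian ϖ ζ) (jbar : 𝔤 →ₗ[ℝ] ObsQuot ϖ)
    (h : ∀ X, projBar ϖ (jbar X) = zetaBar hζ X) :
    ∃ j : 𝔤 →ₗ[ℝ] L0 ϖ, (∀ X, (j X).1.1 = ζ X) ∧ ∀ X, ObsQuot.mk ϖ (j X) = jbar X := by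
  -- Any linear section will do. Composed with `jbar`, its vector field agrees with `ζ` only modulo
  -- $\ker(\iota_\bullet\omega)$.
  obtain ⟨s, hs⟩ := (ObsQuot.mk ϖ).exists_rightInverse_of_surjective
    (LinearMap.range_eq_top.2 ObsQuot.mk_surjective)
  have hs' : ∀ X, ObsQuot.mk ϖ (s (jbar X)) = jbar X := fun X => LinearMap.congr_fun hs _
  have hk : ∀ X, (s (jbar X)).1.1 - ζ X ∈ kerContract ϖ := fun X =>
    (projBar_mk_eq_zetaBar_iff hζ _ X).1 ((congrArg _ (hs' X)).trans (h X))
  have hc : ∀ X, contract (m + 1) (s (jbar X)).1.1 ϖ.1 = contract (m + 1) (ζ X) ϖ.1 := fun X => by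
    have := mem_kerContract.1 (hk X)
    rwa [map_sub, LinearMap.sub_apply, sub_eq_zero] at this
  -- Keep the form component and replace the field by `ζ X`. By `hc` both fields have the same
  -- contraction with `ϖ`, so the pair stays in `L0 ϖ`; it changes only by an element of `kerPart
  -- ϖ`, which dies in the quotient.
  let j : 𝔤 →ₗ[ℝ] L0 ϖ := LinearMap.codRestrict (L0 ϖ)
    ((ζ : 𝔤 →ₗ[ℝ] VF E M).prod (LinearMap.snd ℝ _ _ ∘ₗ (L0 ϖ).subtype ∘ₗ s ∘ₗ jbar))
    fun X => (L0_d (s (jbar X))).trans (by rw [hc]; rfl)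
  refine ⟨j, fun _ => rfl, fun X => ?_⟩
  rw [← hs' X, eq_comm, ← sub_eq_zero, ← map_sub, ObsQuot.mk_eq_zero, mem_sup_iff]
  refine ⟨hk X, ?_⟩
  have : (s (jbar X) - j X).1.2 = 0 := sub_self (s (jbar X)).1.2
  rw [this]
  exact Submodule.zero_mem _

/-- The defect fixes the values of the cocycle because `deRhamIncl` is injective, and these values
fix the tensor. -/
lemma IsLiftCocycle.unique {jbar : 𝔤 →ₗ[ℝ] ObsQuot ϖ} {z z' : Z2 𝔤 ⊗[ℝ] deRham E M m}
    (hz : IsLiftCocycle jbar z) (hz' : IsLiftCocycle jbar z') : z = z' := by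
  apply evalTensor_subtype_injective
  ext X Y
  exact deRhamIncl_injective ((hz X Y).trans (hz' X Y).symm)

/-! ### The cocycle of a lift, its class, and the correction to a homomorphism -/

variable [FiniteDimensional ℝ 𝔤]

/-- The closed form valued cochain `(X, Y) ↦ g₂(X, Y) - α([X, Y])` of a lift `j = (ζ, α)`. -/
noncomputable def closedCochain (j : 𝔤 →ₗ[ℝ] L0 ϖ) (hj : ∀ X, (j X).1.1 = ζ X) :
    twoCochain ℝ 𝔤 (closedForms E M m) :=
  ⟨LinearMap.mk₂ ℝ (fun X Y => ⟨g2 ϖ ζ X Y - (j ⁅X, Y⁆).1.2, closed_cochain j hj X Y⟩)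
    (fun _ _ _ => by ext1; simp; abel) (fun _ _ _ => by ext1; simp [smul_sub])
    (fun _ _ _ => by ext1; simp; abel) (fun _ _ _ => by ext1; simp [smul_sub]),
    fun X => by ext1; simp⟩

/-- The de Rham cohomology valued cochain of a lift of `ζ`. -/
noncomputable def liftCochain (j : 𝔤 →ₗ[ℝ] L0 ϖ) (hj : ∀ X, (j X).1.1 = ζ X) :
    twoCochain ℝ 𝔤 (deRham E M m) :=
  mapCochain (Submodule.mkQ _) (closedCochain j hj)

/-- Already in `L0 ϖ` the field component of the defect cancels, as `ζ` preserves brackets; the form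
component is the one defining `closedCochain`. -/
lemma deRhamIncl_liftCochain (j : 𝔤 →ₗ[ℝ] L0 ϖ) (hj : ∀ X, (j X).1.1 = ζ X) (X Y : 𝔤) :
    deRhamIncl ϖ (liftCochain j hj X Y) =
      ⁅ObsQuot.mk ϖ (j X), ObsQuot.mk ϖ (j Y)⁆ - ObsQuot.mk ϖ (j ⁅X, Y⁆) := by
  rw [ObsQuot.lie_mk, ← map_sub]
  refine congrArg (ObsQuot.mk ϖ) (Subtype.ext (Prod.ext ?_ ?_))
  · change 0 = ⁅(j X).1.1, (j Y).1.1⁆ - (j ⁅X, Y⁆).1.1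
    rw [hj, hj, hj, LieHom.map_lie, sub_self]
  · change contract m (ζ Y) (contract (m + 1) (ζ X) ϖ.1) - (j ⁅X, Y⁆).1.2 =
      contract m (j Y).1.1 (contract (m + 1) (j X).1.1 ϖ.1) - (j ⁅X, Y⁆).1.2
    rw [hj, hj]

/-- The usual argument for central extensions: the cocycle expression is the Jacobi identity of
`ObsQuot ϖ` minus the image under the lift of the Jacobi identity of `𝔤`. -/
lemma liftCochain_closed (j : 𝔤 →ₗ[ℝ] L0 ϖ) (hj : ∀ X, (j X).1.1 = ζ X) (X Y Z : 𝔤) :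
    liftCochain j hj ⁅X, Y⁆ Z - liftCochain j hj ⁅X, Z⁆ Y + liftCochain j hj ⁅Y, Z⁆ X = 0 := by
  apply deRhamIncl_injective (ϖ := ϖ)
  set J : 𝔤 →ₗ[ℝ] ObsQuot ϖ := (ObsQuot.mk ϖ).comp j
  have hc : ∀ X Y, ⁅J X, J Y⁆ = deRhamIncl ϖ (liftCochain j hj X Y) + J ⁅X, Y⁆ := fun X Y => by
    rw [deRhamIncl_liftCochain]; exact (sub_add_cancel _ _).symm
  have hc' : ∀ X Y, deRhamIncl ϖ (liftCochain j hj X Y) = ⁅J X, J Y⁆ - J ⁅X, Y⁆ :=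
    deRhamIncl_liftCochain j hj
  -- $J([X,Y])$ and $[JX,JY]$ differ by a central element, invisible to a further bracket.
  have hb : ∀ X Y Z, ⁅J ⁅X, Y⁆, J Z⁆ = ⁅⁅J X, J Y⁆, J Z⁆ := fun X Y Z => by
    rw [hc X Y, add_lie, deRhamIncl_lie, zero_add]
  have hJac : ∀ {L : Type _} [LieRing L] (x y z : L),
      ⁅⁅x, y⁆, z⁆ - ⁅⁅x, z⁆, y⁆ + ⁅⁅y, z⁆, x⁆ = 0 := fun x y z => by
    rw [← lie_skew ⁅x, z⁆ y, ← lie_skew ⁅y, z⁆ x, leibniz_lie x y z]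
    abel
  have hJac' : ∀ (x y z : 𝔤), ⁅⁅x, y⁆, z⁆ - ⁅⁅x, z⁆, y⁆ + ⁅⁅y, z⁆, x⁆ = 0 := fun x y z => by
    rw [← lie_skew ⁅x, z⁆ y, ← lie_skew ⁅y, z⁆ x, leibniz_lie x y z]
    abel
  rw [map_zero, map_add, map_sub, hc', hc', hc', hb, hb, hb]
  have h1 := hJac (J X) (J Y) (J Z)
  have h2 := congrArg J (hJac' X Y Z)
  rw [map_zero, map_add, map_sub] at h2
  rw [← sub_eq_zero.2 (h1.trans h2.symm)]
  abel

/-- The cochain of a lift of `ζ` represents the class of `g₂`. -/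
lemma cohIncl_classCE_of_liftCochain (j : 𝔤 →ₗ[ℝ] L0 ϖ) (hj : ∀ X, (j X).1.1 = ζ X)
    (z : Z2 𝔤 ⊗[ℝ] deRham E M m)
    (hz : evalTensor 𝔤 (deRham E M m) ((Z2 𝔤).subtype.rTensor _ z) = liftCochain j hj) :
    cohIncl E M 𝔤 m (classCE E M 𝔤 m z) = g2Class ϖ ζ := by
  set t := (Z2 𝔤).subtype.rTensor (deRham E M m) z with ht
  set s := (cochainTensorEquiv 𝔤 (DiffForm E M m)).symm (g2 ϖ ζ)
  have hs' : evalTensor 𝔤 (DiffForm E M m) s = g2 ϖ ζ :=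
    (cochainTensorEquiv 𝔤 (DiffForm E M m)).apply_symm_apply _
  let q := (exactForms E M m).mkQ
  let i := quotIncl (exactForms E M m) (closedForms E M m)
  -- Dividing by coboundaries commutes with including cocycles into cochains; on pure tensors this
  -- is definitional.
  have h1 : cohIncl E M 𝔤 m (classCE E M 𝔤 m z) = (B2 𝔤).mkQ.rTensor _ (i.lTensor _ t) := by
    rw [ht]
    clear_value t
    clear hz ht
    induction z with
    | zero => simp
    | tmul φ v => rfl
    | add a b ha hb => simp only [map_add, ha, hb]
  have h2 : g2Class ϖ ζ = (B2 𝔤).mkQ.rTensor _ (q.lTensor _ s) := by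
    rw [← LinearMap.comp_apply, LinearMap.rTensor_comp_lTensor]
    rfl
  -- The difference of the two cochains is the coboundary whose primitive is the form component of
  -- `j` modulo exact forms.
  have h3 : (B2 𝔤).mkQ.rTensor _ (i.lTensor _ t - q.lTensor _ s) = 0 := by
    refine rTensor_mkQ_eq_zero (q ∘ₗ LinearMap.snd ℝ _ _ ∘ₗ (L0 ϖ).subtype ∘ₗ j) _ ?_
    rw [map_sub, evalTensor_lTensor, evalTensor_lTensor, hz, hs']
    ext X Y
    change q (g2 ϖ ζ X Y - (j ⁅X, Y⁆).1.2) - q (g2 ϖ ζ X Y) = - q (j ⁅X, Y⁆).1.2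
    rw [map_sub]
    abel
  rw [h1, h2, ← sub_eq_zero, ← map_sub, h3]

/-- `h2` is known only through its image under `cohIncl`, so the two classes are compared there,
where the cocycle of every lift of `ζ` has the image of $g_2$. -/
lemma exists_isLiftCocycle (hζ : WeaklyHamiltonian ϖ ζ) (jbar : 𝔤 →ₗ[ℝ] ObsQuot ϖ)
    (h : ∀ X, projBar ϖ (jbar X) = zetaBar hζ X) :
    ∃ z : Z2 𝔤 ⊗[ℝ] deRham E M m, IsLiftCocycle jbar z ∧ classCE E M 𝔤 m z = h2 hζ := by
  obtain ⟨j, hj, hjbar⟩ := exists_lift_of_projBar_eq hζ jbar h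
  obtain ⟨z, hz⟩ := exists_cocycle (liftCochain j hj) (liftCochain_closed j hj)
  refine ⟨z, fun X Y => ?_, cohIncl_injective
    ((cohIncl_classCE_of_liftCochain j hj z hz).trans (cohIncl_h2 hζ).symm)⟩
  rw [hz, deRhamIncl_liftCochain, hjbar, hjbar, hjbar]

lemma IsLiftCocycle.classCE_eq (hζ : WeaklyHamiltonian ϖ ζ) {jbar : 𝔤 →ₗ[ℝ] ObsQuot ϖ}
    (h : ∀ X, projBar ϖ (jbar X) = zetaBar hζ X) {z : Z2 𝔤 ⊗[ℝ] deRham E M m}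
    (hz : IsLiftCocycle jbar z) : classCE E M 𝔤 m z = h2 hζ := by
  obtain ⟨z', hz', hcl⟩ := exists_isLiftCocycle hζ jbar h
  rw [hz.unique hz', hcl]

/-- If the second obstruction class vanishes then `ζ̄` lifts to a Lie algebra homomorphism. -/
lemma exists_lieHom_of_h2_eq_zero (hζ : WeaklyHamiltonian ϖ ζ) (h0 : h2 hζ = 0) :
    ∃ f : 𝔤 →ₗ⁅ℝ⁆ ObsQuot ϖ, ∀ X, projBar ϖ (f X) = zetaBar hζ X := by
  obtain ⟨j, hj⟩ := id hζ
  set J : 𝔤 →ₗ[ℝ] ObsQuot ϖ := (ObsQuot.mk ϖ).comp j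
  have hJ : ∀ X, projBar ϖ (J X) = zetaBar hζ X := fun X => by
    refine (projBar_mk_eq_zetaBar_iff hζ (j X) X).2 ?_
    rw [hj, sub_self]
    exact Submodule.zero_mem _
  obtain ⟨z, hz, hcl⟩ := exists_isLiftCocycle hζ J hJ
  -- The primitive takes values in de Rham cohomology, so it can be subtracted from `J` inside the
  -- central kernel.
  obtain ⟨β, hβ⟩ := exists_cobound_of_rTensor_mkQ_eq_zero z (hcl.trans h0)
  have hJβ : ∀ X Y, ⁅J X, J Y⁆ = J ⁅X, Y⁆ - deRhamIncl ϖ (β ⁅X, Y⁆) := fun X Y => by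
    have := hz X Y
    rw [hβ, cobound_apply, map_neg] at this
    rw [sub_eq_add_neg, this, add_sub_cancel]
  -- The sign is that of `cobound`: the defect of `J` is $-\beta([X,Y])$. Subtracting $\beta$ leaves
  -- $[JX,JY]$ unchanged and lowers $J([X,Y])$ by $\beta([X,Y])$.
  refine ⟨{ J - (deRhamIncl ϖ).comp β with map_lie' := fun {X Y} => ?_ }, fun X => ?_⟩
  · change J ⁅X, Y⁆ - deRhamIncl ϖ (β ⁅X, Y⁆) =
      ⁅J X - deRhamIncl ϖ (β X), J Y - deRhamIncl ϖ (β Y)⁆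
    rw [sub_lie, lie_sub, lie_deRhamIncl, deRhamIncl_lie, sub_zero, sub_zero, hJβ]
  · change projBar ϖ (J X - deRhamIncl ϖ (β X)) = _
    rw [map_sub, projBar_deRhamIncl, sub_zero, hJ]

end Lifts

end Multisymplectic

open Multisymplectic TensorProduct
-- Here $n=m+1$, which encodes $n\ge1$: `ϖ` has degree $m+2=n+1$ and observables have form degree
-- $m=n-1$. For $m=0$ the space `exactForms` is zero.
theorem mainTheorem5 {E : Type*} [NormedAddCommGroup E] [NormedSpace ℝ E] [FiniteDimensional ℝ E]
    {M : Type*} [TopologicalSpace M] [ChartedSpace E M] [IsManifold 𝓘(ℝ, E) ∞ M]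
    {𝔤 : Type*} [LieRing 𝔤] [LieAlgebra ℝ 𝔤] [FiniteDimensional ℝ 𝔤]
    {m : ℕ} (ϖ : closedForms E M (m + 2)) (ζ : 𝔤 →ₗ⁅ℝ⁆ VF E M) (hζ : WeaklyHamiltonian ϖ ζ) :
    ((∃ f : 𝔤 →ₗ⁅ℝ⁆ ObsQuot ϖ, ∀ X, projBar ϖ (f X) = zetaBar hζ X) ↔ h2 hζ = 0) ∧
    (∀ jbar : 𝔤 →ₗ[ℝ] ObsQuot ϖ, (∀ X, projBar ϖ (jbar X) = zetaBar hζ X) →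
      (∃! z : Z2 𝔤 ⊗[ℝ] deRham E M m, IsLiftCocycle jbar z) ∧
      ∀ z : Z2 𝔤 ⊗[ℝ] deRham E M m, IsLiftCocycle jbar z → classCE E M 𝔤 m z = h2 hζ) := by
  refine ⟨⟨?_, exists_lieHom_of_h2_eq_zero hζ⟩, fun jbar h => ⟨?_, fun z hz => hz.classCE_eq hζ h⟩⟩
  · rintro ⟨f, hf⟩
    -- A homomorphism has zero defect, and `h2` is the class of the cocycle of any lift.
    have hz : IsLiftCocycle (f : 𝔤 →ₗ[ℝ] ObsQuot ϖ) (0 : Z2 𝔤 ⊗[ℝ] deRham E M m) := fun X Y => by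
      rw [map_zero, map_zero]
      exact (map_zero (deRhamIncl ϖ)).trans (sub_eq_zero.2 (f.map_lie X Y).symm).symm
    rw [← hz.classCE_eq hζ hf, map_zero]
  · obtain ⟨z, hz, -⟩ := exists_isLiftCocycle hζ jbar h
    exact ⟨z, hz, fun z' hz' => hz'.unique hz⟩
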